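/- Let $k\ge 1$, let $M$ be an oriented Riemannian manifold (smooth, without boundary) of dimension $4k$ with volume form $\epsilon$, and let $\xi$ be an oriented smooth real vector bundle of rank $4k$ over $M$ with a smooth fibre metric $h$ and a smooth connection $D$ compatible with $h$. Let $$R(X,Y)s=D_XD_Ys-D_YD_Xs-D_{[X,Y]}s,\qquad R(X,Y,s,t)=h(R(X,Y)t,s)$$ be its curvature, the latter being regarded as a section of $\Lambda^2T^*M\otimes\Lambda^2\xi^*$. For such bi-forms put $(\varphi_1\otimes\psi_1)\wedge(\varphi_2\otimes\psi_2)=(\varphi_1\wedge\varphi_2)\otimes(\psi_1\wedge\psi_2)$, and let $R^k=R\wedge\cdots\wedge R$ ($k$ factors), a section of $\Lambda^{2k}T^*M\otimes\Lambda^{2k}\xi^*$. Wedge products are normalized so that $(\alpha\wedge\beta)(v_1,\dots,v_{p+q})$ is the signed sum over $(p,q)$-shuffles, and $\Lambda^pV^*\otimes\Lambda^qW^*$, for inner product spaces $V,W$ with orthonormal bases $(e_i)$, $(f_j)$, carries the inner product for which the elements $(e^{i_1}\wedge\cdots\wedge e^{i_p})\otimes(f^{j_1}\wedge\cdots\wedge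 f^{j_q})$, $i_1<\cdots<i_p$, $j_1<\cdots<j_q$, are orthonormal. On an oriented inner product space of dimension $4k$ with volume element $\omega$, the star operator on $2k$-forms, $\alpha\wedge *\beta=(\alpha,\beta)\,\omega$, is an involution; let $\Lambda^{2k}_{\pm}$ be its $\pm1$-eigenspaces. Write $$R^k=(R^k)^+_++(R^k)^+_-+(R^k)^-_++(R^k)^-_-,$$ where $(R^k)^a_b$ is the component in $\Lambda^{2k}_aT^*M\otimes\Lambda^{2k}_b\xi^*$ for the signs $a,b$. The Euler form of $(\xi,h,D)$ is, in a positively oriented orthonormal local frame $s_1,\dots,s_{4k}$ of $\xi$ with dual frame $s^1,\dots,s^{4k}$ and $R^a_b(X,Y)=s^a(R(X,Y)s_b)$, $$e(\xi)=\frac{1}{(2\pi)^{2k}\,2^{2k}\,(2k)!}\sum_{\sigma\in S_{4k}}\operatorname{sign}(\sigma)\,R^{\sigma(1)}_{\sigma(2)}\wedge\cdots\wedge R^{\sigma(4k-1)}_{\sigma(4k)}.$$ Then $e(\xi)$ does not depend on the choice of the positively oriented orthonormal frame, and at every point of $M$ $$e(\xi)=\frac{1}{(2\pi)^{2k}(2k)!}\Bigl(|(R^k)^+_+|^2-|(R^k)^+_-|^2-|(R^k)^-_+|^2+|(R^k)^-_-|^2\Bigr)\,\epsilon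 .$$ -/

import Mathlib

open Bundle Manifold ContDiff Topology FiberBundle VectorField

noncomputable section

/-! ### Forms and bi-forms on vector spaces -/

section Forms

/-- The `p`-forms on `V`, that is `Λ^p V^*`. -/
abbrev Form (p : ℕ) (V : Type*) [AddCommGroup V] [Module ℝ V] := V [⋀^Fin p]→ₗ[ℝ] ℝ

/-- The `(r, s)`-bi-forms `Λ^r V^* ⊗ Λ^s W^*`, as forms on `V` with values in the forms on `W`: the
decomposable element `φ ⊗ ψ` is `v ↦ φ v • ψ`. -/
abbrev BiForm (r s : ℕ) (V W : Type*) [AddCommGroup V] [Module ℝ V] [AddCommGroup W]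
    [Module ℝ W] := V [⋀^Fin r]→ₗ[ℝ] Form s W

section Algebra

variable {V W : Type*} [AddCommGroup V] [Module ℝ V] [AddCommGroup W] [Module ℝ W]
  {N₁ N₂ N : Type*} [AddCommGroup N₁] [Module ℝ N₁] [AddCommGroup N₂] [Module ℝ N₂]
  [AddCommGroup N] [Module ℝ N]

/-- The wedge product of vector-valued forms, where values are multiplied by `m`:
`(α ∧ β) v = ∑ sign σ • m (α (v_{σ 1}, …, v_{σ p})) (β (v_{σ (p + 1)}, …, v_{σ (p + q)}))`, the sum
being over the `(p, q)`-shuffles `σ`. -/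
def wedgeWith (m : N₁ →ₗ[ℝ] N₂ →ₗ[ℝ] N) {p q : ℕ} :
    (V [⋀^Fin p]→ₗ[ℝ] N₁) →ₗ[ℝ] (V [⋀^Fin q]→ₗ[ℝ] N₂) →ₗ[ℝ] (V [⋀^Fin (p + q)]→ₗ[ℝ] N) :=
  TensorProduct.curry
    ((AlternatingMap.domDomCongrₗ ℝ finSumFinEquiv).toLinearMap ∘ₗ
      LinearMap.compAlternatingMapₗ ℝ (TensorProduct.lift m) ∘ₗ AlternatingMap.domCoprod')

/-- The wedge product of forms. -/
def Form.wedge {p q : ℕ} : Form p V →ₗ[ℝ] Form q V →ₗ[ℝ] Form (p + q) V :=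
  wedgeWith (LinearMap.mul ℝ ℝ)

/-- The wedge product of bi-forms: `(φ₁ ⊗ ψ₁) ∧ (φ₂ ⊗ ψ₂) = (φ₁ ∧ φ₂) ⊗ (ψ₁ ∧ ψ₂)`. -/
def BiForm.wedge {r s r' s' : ℕ} :
    BiForm r s V W →ₗ[ℝ] BiForm r' s' V W →ₗ[ℝ] BiForm (r + r') (s + s') V W :=
  wedgeWith Form.wedge

/-- The power `R^p = R ∧ ⋯ ∧ R` of a `(2, 2)`-bi-form. -/
def BiForm.pow (R : BiForm 2 2 V W) : (p : ℕ) → BiForm (2 * p) (2 * p) V W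
  | 0 => AlternatingMap.constOfIsEmpty ℝ V (Fin 0) (AlternatingMap.constOfIsEmpty ℝ W (Fin 0) 1)
  | p + 1 => BiForm.wedge (BiForm.pow R p) R

/-- The wedge product `η_0 ∧ ⋯ ∧ η_{m - 1}` of two-forms. -/
def Form.wedgeProd : {m : ℕ} → (Fin m → Form 2 V) → Form (2 * m) V
  | 0, _ => AlternatingMap.constOfIsEmpty ℝ V (Fin 0) 1
  | m + 1, η => Form.wedge (Form.wedgeProd fun i : Fin m ↦ η i.castSucc) (η (Fin.last m))

/-- A `p`-form as a `q`-form, when `p = q`. -/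
def Form.cast {p q : ℕ} (h : p = q) (η : Form p V) : Form q V := η.domDomCongr (finCongr h)

theorem append_update {p q : ℕ} [DecidableEq (Fin q)] (v : Fin p → V) (w : Fin q → V) (i : Fin q)
    (c : V) : Fin.append v (Function.update w i c) =
      Function.update (Fin.append v w) (Fin.natAdd p i) c := by
  ext j
  refine Fin.addCases (fun j ↦ ?_) (fun j ↦ ?_) j
  · have : Fin.castAdd q j ≠ Fin.natAdd p i := fun h ↦ by
      have := congrArg Fin.val h
      simp at this
      omega
    simp [Function.update_of_ne this]
  · by_cases hj : j = i
    · subst hj; simp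
    · have : Fin.natAdd p j ≠ Fin.natAdd p i := fun h ↦ hj (by simpa using h)
      simp [Function.update_of_ne this, Function.update_of_ne hj]

/-- The form `w ↦ η (v_1, …, v_p, w_1, …, w_q)`. -/
def Form.contract {p q : ℕ} (η : Form (p + q) V) (v : Fin p → V) : Form q V where
  toFun w := η (Fin.append v w)
  map_update_add' := fun w i a b ↦ by simp only [append_update, AlternatingMap.map_update_add]
  map_update_smul' := fun w i c a ↦ by simp only [append_update, AlternatingMap.map_update_smul]
  map_eq_zero_of_eq' := fun w i j h hij ↦
    η.map_eq_zero_of_eq _ (i := Fin.natAdd p i) (j := Fin.natAdd p j) (by simpa using h)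
      (fun h ↦ hij (by simpa using h))

/-- The bi-form with the two factors of the tensor product interchanged. -/
def BiForm.flip {r s : ℕ} (T : BiForm r s V W) : BiForm s r W V where
  toFun w :=
    { toFun := fun v ↦ T v w
      map_update_add' := fun v i a b ↦ by rw [T.map_update_add]; rfl
      map_update_smul' := fun v i c a ↦ by rw [T.map_update_smul]; rfl
      map_eq_zero_of_eq' := fun v i j h hij ↦ by rw [T.map_eq_zero_of_eq v h hij]; rfl }
  map_update_add' := fun w i a b ↦ AlternatingMap.ext fun v ↦ (T v).map_update_add w i a b
  map_update_smul' := fun w i c a ↦ AlternatingMap.ext fun v ↦ (T v).map_update_smul w i c a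
  map_eq_zero_of_eq' := fun w i j h hij ↦
    AlternatingMap.ext fun v ↦ (T v).map_eq_zero_of_eq w h hij

end Algebra

section Metric

variable {V W : Type*} [NormedAddCommGroup V] [InnerProductSpace ℝ V] [FiniteDimensional ℝ V]
  [NormedAddCommGroup W] [InnerProductSpace ℝ W] [FiniteDimensional ℝ W] {n : ℕ}

/-- The vectors `e_{i_1}, …, e_{i_p}` of an orthonormal basis of `V`, for `i_1 < ⋯ < i_p`. -/
def basisTuple (V : Type*) [NormedAddCommGroup V] [InnerProductSpace ℝ V] [FiniteDimensional ℝ V]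
    {p : ℕ} (i : Fin p ↪o Fin (Module.finrank ℝ V)) : Fin p → V :=
  fun a ↦ stdOrthonormalBasis ℝ V (i a)

/-- The squared norm `|T|^2` of a bi-form, for which the elements
`(e^{i_1} ∧ ⋯ ∧ e^{i_r}) ⊗ (f^{j_1} ∧ ⋯ ∧ f^{j_s})` are orthonormal. -/
def BiForm.normSq {r s : ℕ} (T : BiForm r s V W) : ℝ :=
  ∑ i : Fin r ↪o Fin (Module.finrank ℝ V), ∑ j : Fin s ↪o Fin (Module.finrank ℝ W),
    T (basisTuple V i) (basisTuple W j) ^ 2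

/-- The volume element `ε = e^1 ∧ ⋯ ∧ e^n` of an oriented inner product space. -/
def volumeElement (hV : Module.finrank ℝ V = n) (o : Orientation ℝ V (Fin n)) : Form n V :=
  haveI : Fact (Module.finrank ℝ V = n) := ⟨hV⟩
  o.volumeForm

/-- The star operator `Λ^p V^* → Λ^q V^*`, `p + q = n`, which takes `e^{i_1} ∧ ⋯ ∧ e^{i_p}` to the
contraction `ε (e_{i_1}, …, e_{i_p}, ⋯)` of the volume element. -/
def Form.star (hV : Module.finrank ℝ V = n) (o : Orientation ℝ V (Fin n)) {p q : ℕ}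
    (h : p + q = n) : Form p V →ₗ[ℝ] Form q V where
  toFun β := ∑ i : Fin p ↪o Fin (Module.finrank ℝ V),
    β (basisTuple V i) • (Form.cast h.symm (volumeElement hV o)).contract (basisTuple V i)
  map_add' := fun α β ↦ by simp [add_smul, Finset.sum_add_distrib]
  map_smul' := fun c β ↦ by simp [mul_smul, Finset.smul_sum]

/-- For a sign `a`, the part `T^a = (T + a *T) / 2` of a bi-form, where `*` acts on the first factor
`Λ^{2k} V^*`, `dim V = 4k`: the projection of `T` to `Λ^{2k}_± V^* ⊗ Λ^s W^*`. -/
def BiForm.leftPart {k s : ℕ} (hV : Module.finrank ℝ V = 4 * k) (o : Orientation ℝ V (Fin (4 * k)))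
    (a : ℤˣ) (T : BiForm (2 * k) s V W) : BiForm (2 * k) s V W :=
  (1 / 2 : ℝ) • (T + a • BiForm.flip
    ((Form.star hV o (show 2 * k + 2 * k = 4 * k by ring)).compAlternatingMap (BiForm.flip T)))

/-- For a sign `a`, the part `T_a = (T + a *T) / 2` of a bi-form, where `*` acts on the second factor
`Λ^{2k} W^*`, `dim W = 4k`: the projection of `T` to `Λ^r V^* ⊗ Λ^{2k}_± W^*`. -/
def BiForm.rightPart {k r : ℕ} (hW : Module.finrank ℝ W = 4 * k) (o : Orientation ℝ W (Fin (4 * k)))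
    (a : ℤˣ) (T : BiForm r (2 * k) V W) : BiForm r (2 * k) V W :=
  (1 / 2 : ℝ) • (T + a •
    (Form.star hW o (show 2 * k + 2 * k = 4 * k by ring)).compAlternatingMap T)

end Metric

end Forms

/-! ### Curvature of a connection on a vector bundle -/

namespace CovariantDerivative

section functions

variable {E : Type*} [NormedAddCommGroup E] [NormedSpace ℝ E]
  {H : Type*} [TopologicalSpace H] {I : ModelWithCorners ℝ E H}
  {M : Type*} [TopologicalSpace M] [ChartedSpace H M] [IsManifold I ∞ M] [I.Boundaryless]

theorem fderiv_comp_extChartAt_symm {h : M → ℝ} (x : M) {z : E} (hz : z ∈ (extChartAt I x).target)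
    (Z : Π y : M, TangentSpace I y) (hh : MDiffAt h ((extChartAt I x).symm z)) :
    fderiv ℝ (h ∘ (extChartAt I x).symm) z (mpullback 𝓘(ℝ, E) I (extChartAt I x).symm Z z) =
      (d% h) ((extChartAt I x).symm z) (Z ((extChartAt I x).symm z)) := by
  have hinv := isInvertible_mfderivWithin_extChartAt_symm (I := I) hz
  rw [I.range_eq_univ, mfderivWithin_univ] at hinv
  have hd : MDiffAt (extChartAt I x).symm z := by
    have := mdifferentiableWithinAt_extChartAt_symm (I := I) hz
    rwa [I.range_eq_univ, mdifferentiableWithinAt_univ] at this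
  rw [← mfderiv_eq_fderiv, mfderiv_comp z hh hd, mpullback_apply]
  exact congrArg (mfderiv% h ((extChartAt I x).symm z))
    (hinv.self_apply_inverse (Z ((extChartAt I x).symm z)))

theorem contDiffAt_comp_extChartAt_symm {f : M → ℝ} {x : M}
    (hf : ∀ᶠ y in 𝓝 x, CMDiffAt ∞ f y) :
    ContDiffAt ℝ 2 (f ∘ (extChartAt I x).symm) (extChartAt I x x) := by
  have h2 := (contMDiffAt_iff.1 (hf.self_of_nhds.of_le (m := 2) ENat.LEInfty.out)).2
  rw [I.range_eq_univ, contDiffWithinAt_univ] at h2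
  exact h2

variable [FiniteDimensional ℝ E]

theorem differentiableAt_mpullback_extChartAt_symm {x : M} {Z : Π y : M, TangentSpace I y}
    (hZ : MDiffAt (T% Z) x) :
    DifferentiableAt ℝ (mpullback 𝓘(ℝ, E) I (extChartAt I x).symm Z) (extChartAt I x x) := by
  have := MDifferentiableWithinAt.differentiableWithinAt_mpullbackWithin_vectorField
    (s := Set.univ) (V := Z) (x := x) hZ.mdifferentiableWithinAt
  rw [I.range_eq_univ, mpullbackWithin_univ, Set.preimage_univ, Set.inter_self] at this
  exact differentiableWithinAt_univ.1 this

theorem mvfderiv_apply_aux {f : M → ℝ} {x : M} {Z : Π y : M, TangentSpace I y}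
    (hf : ∀ᶠ y in 𝓝 x, CMDiffAt ∞ f y) (hZ : MDiffAt (T% Z) x) :
    MDiffAt (fun y ↦ (d% f) y (Z y)) x ∧ ∀ W : Π y : M, TangentSpace I y,
      (d% (fun y ↦ (d% f) y (Z y))) x (W x) =
      fderiv ℝ (fun z ↦ fderiv ℝ (f ∘ (extChartAt I x).symm) z
          (mpullback 𝓘(ℝ, E) I (extChartAt I x).symm Z z)) (extChartAt I x x)
        (mpullback 𝓘(ℝ, E) I (extChartAt I x).symm W (extChartAt I x x)) := by
  set φ := extChartAt I x with hφ
  have ha : φ x ∈ φ.target := mem_extChartAt_target x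
  have hsymm : φ.symm (φ x) = x := extChartAt_to_inv x
  have hdiff : DifferentiableAt ℝ
      (fun z ↦ fderiv ℝ (f ∘ φ.symm) z (mpullback 𝓘(ℝ, E) I φ.symm Z z)) (φ x) := by
    have h1 : DifferentiableAt ℝ (fderiv ℝ (f ∘ φ.symm)) (φ x) :=
      ((contDiffAt_comp_extChartAt_symm hf).fderiv_right (m := 1)
        (by norm_num)).differentiableAt one_ne_zero
    exact h1.clm_apply (differentiableAt_mpullback_extChartAt_symm hZ)
  have hfev : ∀ᶠ y in 𝓝 x, MDiffAt f y := by
    filter_upwards [hf] with y hy using ContMDiffAt.mdifferentiableAt hy (by simp)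
  have hev : ∀ᶠ z in 𝓝 (φ x), MDiffAt f (φ.symm z) := by
    have hc : Filter.Tendsto φ.symm (𝓝 (φ x)) (𝓝 x) := by
      have := continuousAt_extChartAt_symm (I := I) x
      rwa [ContinuousAt, extChartAt_to_inv] at this
    exact hc.eventually hfev
  have heq : (fun z ↦ fderiv ℝ (f ∘ φ.symm) z (mpullback 𝓘(ℝ, E) I φ.symm Z z)) =ᶠ[𝓝 (φ x)]
      (fun y ↦ (d% f) y (Z y)) ∘ φ.symm := by
    filter_upwards [hev, extChartAt_target_mem_nhds (I := I) x] with z hz hzt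
    exact fderiv_comp_extChartAt_symm x hzt Z hz
  have hM : MDiffAt (fun y ↦ (d% f) y (Z y)) x := by
    have h1 : MDiffAt ((fun z ↦ fderiv ℝ (f ∘ φ.symm) z
        (mpullback 𝓘(ℝ, E) I φ.symm Z z)) ∘ φ) x :=
      hdiff.mdifferentiableAt.comp x (mdifferentiableAt_extChartAt (mem_chart_source H x))
    refine h1.congr_of_eventuallyEq ?_
    filter_upwards [hfev, extChartAt_source_mem_nhds (I := I) x] with y hy hys
    have h3 := fderiv_comp_extChartAt_symm (h := f) x (φ.map_source hys) Z
      (by rw [φ.left_inv hys]; exact hy)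
    simp only [Function.comp_apply]
    rw [h3, ← hφ]
    rw [φ.left_inv hys]
  refine ⟨hM, fun W ↦ ?_⟩
  rw [heq.fderiv_eq, fderiv_comp_extChartAt_symm (h := fun y ↦ (d% f) y (Z y)) x ha W
    (by rw [← hφ, hsymm]; exact hM), ← hφ, hsymm]

/-- `[X, Y] f = X (Y f) - Y (X f)` for a function `f` that is smooth near `x`. -/
theorem mvfderiv_mlieBracket {f : M → ℝ} {x : M} {X Y : Π y : M, TangentSpace I y}
    (hf : ∀ᶠ y in 𝓝 x, CMDiffAt ∞ f y) (hX : MDiffAt (T% X) x) (hY : MDiffAt (T% Y) x) :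
    (d% f) x (mlieBracket I X Y x) =
      (d% (fun y ↦ (d% f) y (Y y))) x (X x) - (d% (fun y ↦ (d% f) y (X y))) x (Y x) := by
  have hg := contDiffAt_comp_extChartAt_symm hf
  rw [(mvfderiv_apply_aux hf hY).2 X, (mvfderiv_apply_aux hf hX).2 Y,
    ← fderiv_apply_lieBracket hg (by simp) (differentiableAt_mpullback_extChartAt_symm hY)
      (differentiableAt_mpullback_extChartAt_symm hX),
    ← mlieBracketWithin_univ, mlieBracketWithin_apply]
  simp only [I.range_eq_univ, mpullbackWithin_univ, Set.preimage_univ, Set.inter_self]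
  set φ := extChartAt I x with hφ
  have hfx : f =ᶠ[𝓝 x] (f ∘ φ.symm) ∘ φ := by
    filter_upwards [extChartAt_source_mem_nhds (I := I) x] with y hy
    simp [φ.left_inv hy]
  have hmf : mfderiv% f x = (fderiv ℝ (f ∘ φ.symm) (φ x)).comp (mfderiv% φ x) := by
    rw [hfx.mfderiv_eq, ← mfderiv_eq_fderiv]
    exact mfderiv_comp x (hg.differentiableAt (by simp)).mdifferentiableAt
      (mdifferentiableAt_extChartAt (mem_chart_source H x))
  have hinv : (mfderiv% φ x).IsInvertible :=
    isInvertible_mfderiv_extChartAt (mem_extChartAt_source x)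
  change (mfderiv% f x) _ = _
  rw [hmf]
  refine (congrArg (fderiv ℝ (f ∘ φ.symm) (φ x)) (hinv.self_apply_inverse _)).trans ?_
  exact congrArg (fun v : E → E ↦ fderiv ℝ (f ∘ φ.symm) (φ x) (v (φ x))) lieBracketWithin_univ

end functions

section curvature

variable {E : Type*} [NormedAddCommGroup E] [NormedSpace ℝ E] [FiniteDimensional ℝ E]
  {H : Type*} [TopologicalSpace H] {I : ModelWithCorners ℝ E H}
  {M : Type*} [TopologicalSpace M] [T2Space M] [ChartedSpace H M] [IsManifold I ∞ M]
  {F : Type*} [NormedAddCommGroup F] [NormedSpace ℝ F]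
  {V : M → Type*} [TopologicalSpace (TotalSpace F V)]
  [∀ x, AddCommGroup (V x)] [∀ x, Module ℝ (V x)]
  [∀ x : M, TopologicalSpace (V x)]
  [∀ x, IsTopologicalAddGroup (V x)] [∀ x, ContinuousSMul ℝ (V x)]
  [FiberBundle F V] [VectorBundle ℝ F V]

theorem eventually_contMDiffAt (D : CovariantDerivative I F V)
    [hD : ContMDiffCovariantDerivative D ∞] {σ : Π x : M, V x} {x : M}
    (hσ : ∀ᶠ y in 𝓝 x, CMDiffAt ∞ (T% σ) y) :
    ∀ᶠ y in 𝓝 x, ContMDiffAt I (I.prod 𝓘(ℝ, E →L[ℝ] F)) ∞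
      (fun z ↦ (⟨z, D σ z⟩ : TotalSpace (E →L[ℝ] F) fun z ↦ TangentSpace I z →L[ℝ] V z)) y := by
  obtain ⟨U, hU, hUo, hxU⟩ := eventually_nhds_iff.1 hσ
  obtain ⟨χ, -, hχ⟩ := (SmoothBumpFunction.nhds_basis_tsupport (I := I) x).mem_iff.1
    (hUo.mem_nhds hxU)
  have hs : CMDiff ∞ (T% ((χ : M → ℝ) • σ)) :=
    ContMDiffOn.smul_section_of_tsupport χ.contMDiff.contMDiffOn hUo hχ
      (fun y hy ↦ (hU y hy).contMDiffWithinAt)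
  have h1 := hD.contMDiff.contMDiff (σ := (χ : M → ℝ) • σ) (by simpa using hs.contMDiffOn)
  have heq : ∀ᶠ y in 𝓝 x, D ((χ : M → ℝ) • σ) y = D σ y := by
    filter_upwards [χ.eventuallyEq_one.eventually_nhds, hUo.mem_nhds hxU] with y hy hyU
    refine D.isCovariantDerivativeOnUniv.congr_of_eventuallyEq
      (hs.contMDiffAt.mdifferentiableAt (by simp)) ((hU y hyU).mdifferentiableAt (by simp))
      Filter.univ_mem ?_
    filter_upwards [hy] with z hz
    simp [hz]
  filter_upwards [heq.eventually_nhds] with y hy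
  refine (h1.contMDiffAt Filter.univ_mem).congr_of_eventuallyEq ?_
  filter_upwards [hy] with z hz
  simp [hz]

theorem mdifferentiableAt_apply (D : CovariantDerivative I F V)
    [hD : ContMDiffCovariantDerivative D ∞] {σ : Π x : M, V x} {x : M}
    {X : Π y : M, TangentSpace I y}
    (hσ : ∀ᶠ y in 𝓝 x, CMDiffAt ∞ (T% σ) y) (hX : MDiffAt (T% X) x) :
    MDiffAt (T% (fun y ↦ D σ y (X y))) x :=
  MDifferentiableAt.clm_bundle_apply (F₁ := E) (F₂ := F)
    ((D.eventually_contMDiffAt hσ).self_of_nhds.mdifferentiableAt (by simp)) hX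

/-- `D_X D_Y s - D_Y D_X s - D_{[X, Y]} s` at the point `x`. -/
def curvatureOp (D : CovariantDerivative I F V) (X Y : Π y : M, TangentSpace I y)
    (s : Π y : M, V y) (x : M) : V x :=
  D (fun y ↦ D s y (Y y)) x (X x) - D (fun y ↦ D s y (X y)) x (Y x) - D s x (mlieBracket I X Y x)

theorem eventually_contMDiffAt_extend [ContMDiffVectorBundle ∞ F V I] {x : M} (v : V x) :
    ∀ᶠ y in 𝓝 x, CMDiffAt ∞ (T% (extend F v)) y := by
  obtain ⟨s, hs, h⟩ := exists_contMDiffOn_extend (k := ∞) I F v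
  filter_upwards [eventually_mem_nhds_iff.2 hs] with y hy using h.contMDiffAt hy

theorem curvatureOp_swap (D : CovariantDerivative I F V) (X Y : Π y : M, TangentSpace I y)
    (s : Π y : M, V y) (x : M) : D.curvatureOp Y X s x = - D.curvatureOp X Y s x := by
  rw [curvatureOp, curvatureOp, mlieBracket_swap_apply (V := Y), map_neg]
  abel

theorem curvatureOp_add_left (D : CovariantDerivative I F V) [ContMDiffCovariantDerivative D ∞]
    {X X' Y : Π y : M, TangentSpace I y} {s : Π y : M, V y} {x : M}
    (hX : MDiffAt (T% X) x) (hX' : MDiffAt (T% X') x)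
    (hs : ∀ᶠ y in 𝓝 x, CMDiffAt ∞ (T% s) y) :
    D.curvatureOp (X + X') Y s x = D.curvatureOp X Y s x + D.curvatureOp X' Y s x := by
  have h1 : (fun y ↦ D s y ((X + X') y)) = (fun y ↦ D s y (X y)) + fun y ↦ D s y (X' y) := by
    ext y; simp
  rw [curvatureOp, h1, D.isCovariantDerivativeOnUniv.add (D.mdifferentiableAt_apply hs hX)
    (D.mdifferentiableAt_apply hs hX'), mlieBracket_add_left hX hX']
  simp only [curvatureOp, Pi.add_apply, map_add, _root_.add_apply]
  abel

theorem curvatureOp_smul_left (D : CovariantDerivative I F V) [ContMDiffCovariantDerivative D ∞]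
    {X Y : Π y : M, TangentSpace I y} {s : Π y : M, V y} {x : M} {f : M → ℝ} (hf : MDiffAt f x)
    (hX : MDiffAt (T% X) x) (hs : ∀ᶠ y in 𝓝 x, CMDiffAt ∞ (T% s) y) :
    D.curvatureOp (f • X) Y s x = f x • D.curvatureOp X Y s x := by
  have h1 : (fun y ↦ D s y ((f • X) y)) = f • (fun y ↦ D s y (X y)) := by
    ext y; simp
  rw [curvatureOp, h1, D.isCovariantDerivativeOnUniv.leibniz (D.mdifferentiableAt_apply hs hX) hf,
    mlieBracket_smul_left hf hX]
  simp [curvatureOp]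
  module

theorem curvatureOp_add (D : CovariantDerivative I F V) [ContMDiffCovariantDerivative D ∞]
    {X Y : Π y : M, TangentSpace I y} {s t : Π y : M, V y} {x : M}
    (hX : MDiffAt (T% X) x) (hY : MDiffAt (T% Y) x)
    (hs : ∀ᶠ y in 𝓝 x, CMDiffAt ∞ (T% s) y) (ht : ∀ᶠ y in 𝓝 x, CMDiffAt ∞ (T% t) y) :
    D.curvatureOp X Y (s + t) x = D.curvatureOp X Y s x + D.curvatureOp X Y t x := by
  have hst : ∀ᶠ y in 𝓝 x, CMDiffAt ∞ (T% (s + t)) y := by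
    filter_upwards [hs, ht] with y h1 h2 using h1.add_section h2
  have hD : ∀ᶠ y in 𝓝 x, D (s + t) y = D s y + D t y := by
    filter_upwards [hs, ht] with y h1 h2
    exact D.isCovariantDerivativeOnUniv.add (h1.mdifferentiableAt (by simp))
      (h2.mdifferentiableAt (by simp))
  have key : ∀ {Z : Π y : M, TangentSpace I y}, MDiffAt (T% Z) x →
      D (fun y ↦ D (s + t) y (Z y)) x =
        D (fun y ↦ D s y (Z y)) x + D (fun y ↦ D t y (Z y)) x := by
    intro Z hZ
    rw [← D.isCovariantDerivativeOnUniv.add (D.mdifferentiableAt_apply hs hZ)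
      (D.mdifferentiableAt_apply ht hZ)]
    refine D.isCovariantDerivativeOnUniv.congr_of_eventuallyEq (D.mdifferentiableAt_apply hst hZ)
      (mdifferentiableAt_add_section (D.mdifferentiableAt_apply hs hZ)
        (D.mdifferentiableAt_apply ht hZ)) Filter.univ_mem ?_
    filter_upwards [hD] with y hy
    simp [hy]
  simp only [curvatureOp, key hX, key hY, hD.self_of_nhds, _root_.add_apply]
  abel

theorem curvatureOp_smul [I.Boundaryless] (D : CovariantDerivative I F V)
    [ContMDiffCovariantDerivative D ∞]
    {X Y : Π y : M, TangentSpace I y} {s : Π y : M, V y} {f : M → ℝ} {x : M}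
    (hX : MDiffAt (T% X) x) (hY : MDiffAt (T% Y) x)
    (hf : ∀ᶠ y in 𝓝 x, CMDiffAt ∞ f y) (hs : ∀ᶠ y in 𝓝 x, CMDiffAt ∞ (T% s) y) :
    D.curvatureOp X Y (f • s) x = f x • D.curvatureOp X Y s x := by
  have hfs : ∀ᶠ y in 𝓝 x, CMDiffAt ∞ (T% (f • s)) y := by
    filter_upwards [hf, hs] with y h1 h2 using h1.smul_section h2
  have hD : ∀ᶠ y in 𝓝 x, D (f • s) y = f y • D s y + (d% f y).smulRight (s y) := by
    filter_upwards [hf, hs] with y h1 h2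
    exact D.isCovariantDerivativeOnUniv.leibniz (h2.mdifferentiableAt (by simp))
      (h1.mdifferentiableAt (by simp))
  have hfx : MDiffAt f x := hf.self_of_nhds.mdifferentiableAt (by simp)
  have hsx : MDiffAt (T% s) x := hs.self_of_nhds.mdifferentiableAt (by simp)
  have key : ∀ {Z : Π y : M, TangentSpace I y}, MDiffAt (T% Z) x →
      D (fun y ↦ D (f • s) y (Z y)) x =
        f x • D (fun y ↦ D s y (Z y)) x + (d% f x).smulRight (D s x (Z x)) +
        ((d% f) x (Z x) • D s x + (d% (fun y ↦ (d% f) y (Z y)) x).smulRight (s x)) := by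
    intro Z hZ
    have h1 := D.mdifferentiableAt_apply hs hZ
    have h2 := (mvfderiv_apply_aux hf hZ).1
    rw [← D.isCovariantDerivativeOnUniv.leibniz h1 hfx,
      ← D.isCovariantDerivativeOnUniv.leibniz (g := fun y ↦ (d% f) y (Z y)) hsx h2,
      ← D.isCovariantDerivativeOnUniv.add (hfx.smul_section h1) (h2.smul_section hsx)]
    refine D.isCovariantDerivativeOnUniv.congr_of_eventuallyEq (D.mdifferentiableAt_apply hfs hZ)
      (mdifferentiableAt_add_section (hfx.smul_section h1) (h2.smul_section hsx))
      Filter.univ_mem ?_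
    filter_upwards [hD] with y hy
    simp [hy]
  simp only [curvatureOp, key hX, key hY, hD.self_of_nhds, _root_.add_apply, _root_.smul_apply,
    ContinuousLinearMap.smulRight_apply, mvfderiv_mlieBracket hf hX hY]
  module

theorem curvatureOp_congr_of_eventuallyEq (D : CovariantDerivative I F V)
    [ContMDiffCovariantDerivative D ∞]
    {X Y : Π y : M, TangentSpace I y} {s t : Π y : M, V y} {x : M}
    (hX : MDiffAt (T% X) x) (hY : MDiffAt (T% Y) x)
    (hs : ∀ᶠ y in 𝓝 x, CMDiffAt ∞ (T% s) y) (ht : ∀ᶠ y in 𝓝 x, CMDiffAt ∞ (T% t) y)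
    (hst : ∀ᶠ y in 𝓝 x, s y = t y) :
    D.curvatureOp X Y s x = D.curvatureOp X Y t x := by
  have hD : ∀ᶠ y in 𝓝 x, D s y = D t y := by
    filter_upwards [hs, ht, hst.eventually_nhds] with y h1 h2 h3
    exact D.isCovariantDerivativeOnUniv.congr_of_eventuallyEq (h1.mdifferentiableAt (by simp))
      (h2.mdifferentiableAt (by simp)) Filter.univ_mem h3
  have key : ∀ {Z : Π y : M, TangentSpace I y}, MDiffAt (T% Z) x →
      D (fun y ↦ D s y (Z y)) x = D (fun y ↦ D t y (Z y)) x := by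
    intro Z hZ
    refine D.isCovariantDerivativeOnUniv.congr_of_eventuallyEq (D.mdifferentiableAt_apply hs hZ)
      (D.mdifferentiableAt_apply ht hZ) Filter.univ_mem ?_
    filter_upwards [hD] with y hy
    simp [hy]
  simp only [curvatureOp, key hX, key hY, hD.self_of_nhds]

theorem curvatureOp_sum [I.Boundaryless] (D : CovariantDerivative I F V)
    [ContMDiffCovariantDerivative D ∞] {ι : Type*} (u : Finset ι)
    {X Y : Π y : M, TangentSpace I y} {s : ι → Π y : M, V y} {x : M}
    (hX : MDiffAt (T% X) x) (hY : MDiffAt (T% Y) x)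
    (hs : ∀ i, ∀ᶠ y in 𝓝 x, CMDiffAt ∞ (T% (s i)) y) :
    (∀ᶠ y in 𝓝 x, CMDiffAt ∞ (T% (∑ i ∈ u, s i)) y) ∧
    D.curvatureOp X Y (∑ i ∈ u, s i) x = ∑ i ∈ u, D.curvatureOp X Y (s i) x := by
  classical
  induction u using Finset.induction_on with
  | empty =>
    have h0 : ∀ᶠ y in 𝓝 x, CMDiffAt ∞ (T% (0 : Π y : M, V y)) y :=
      Filter.Eventually.of_forall fun y ↦ (contMDiff_zeroSection ℝ V).contMDiffAt
    refine ⟨h0, ?_⟩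
    have := D.curvatureOp_smul (f := fun _ ↦ 0) hX hY
      (Filter.Eventually.of_forall fun y ↦ contMDiffAt_const) h0
    simp only [zero_smul] at this
    rw [Finset.sum_empty, Finset.sum_empty, ← this]
    congr 1
    ext y
    simp
  | insert a u ha ih =>
    rw [Finset.sum_insert ha, Finset.sum_insert ha, D.curvatureOp_add hX hY (hs a) ih.1, ih.2]
    refine ⟨?_, rfl⟩
    filter_upwards [hs a, ih.1] with y h1 h2 using h1.add_section h2

/-- The curvature is tensorial: `curvatureOp` only depends on the values of the fields at `x`. -/
theorem curvatureOp_congr [I.Boundaryless] [FiniteDimensional ℝ F] [ContMDiffVectorBundle ∞ F V I]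
    (D : CovariantDerivative I F V) [ContMDiffCovariantDerivative D ∞]
    {X X' Y Y' : Π y : M, TangentSpace I y} {s t : Π y : M, V y} {x : M}
    (hX : MDiffAt (T% X) x) (hX' : MDiffAt (T% X') x)
    (hY : MDiffAt (T% Y) x) (hY' : MDiffAt (T% Y') x)
    (hs : ∀ᶠ y in 𝓝 x, CMDiffAt ∞ (T% s) y) (ht : ∀ᶠ y in 𝓝 x, CMDiffAt ∞ (T% t) y)
    (hXX : X x = X' x) (hYY : Y x = Y' x) (hst : s x = t x) :
    D.curvatureOp X Y s x = D.curvatureOp X' Y' t x := by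
  have hleft : ∀ (Z : Π y : M, TangentSpace I y),
      TensorialAt I E (fun W : Π y : M, TangentSpace I y ↦ D.curvatureOp W Z s x) x := fun Z ↦
    { smul := fun hf hW ↦ D.curvatureOp_smul_left hf hW hs
      add := fun hW hW' ↦ D.curvatureOp_add_left hW hW' hs }
  have h1 : D.curvatureOp X Y s x = D.curvatureOp X' Y' s x := by
    rw [(hleft Y).pointwise hX hX' hXX, curvatureOp_swap, (hleft X').pointwise hY hY' hYY,
      ← curvatureOp_swap]
  rw [h1]
  let e := trivializationAt F V x
  have hxe : x ∈ e.baseSet := FiberBundle.mem_baseSet_trivializationAt F V x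
  let b := Module.Basis.ofVectorSpace ℝ F
  let r := e.localFrame b
  let c := e.localFrameCoeff I b
  have hr : ∀ i, ∀ᶠ y in 𝓝 x, CMDiffAt ∞ (T% (r i)) y := fun i ↦ by
    filter_upwards [e.open_baseSet.mem_nhds hxe] with y hy
    exact contMDiffAt_localFrame_of_mem ∞ _ b i hy
  have hc : ∀ {σ : Π y : M, V y}, (∀ᶠ y in 𝓝 x, CMDiffAt ∞ (T% σ) y) → ∀ i,
      ∀ᶠ y in 𝓝 x, CMDiffAt ∞ (LinearMap.piApply (c i) σ) y := fun {σ} hσ i ↦ by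
    filter_upwards [hσ, e.open_baseSet.mem_nhds hxe] with y h hy
    exact contMDiffAt_localFrameCoeff b hy h i
  have hexp : ∀ {σ : Π y : M, V y}, (∀ᶠ y in 𝓝 x, CMDiffAt ∞ (T% σ) y) →
      D.curvatureOp X' Y' σ x = ∑ i, c i x (σ x) • D.curvatureOp X' Y' (r i) x := by
    intro σ hσ
    have hcr : ∀ i, ∀ᶠ y in 𝓝 x, CMDiffAt ∞ (T% (LinearMap.piApply (c i) σ • r i)) y := fun i ↦ by
      filter_upwards [hc hσ i, hr i] with y h h' using h.smul_section h'
    obtain ⟨hsm, hsum⟩ := D.curvatureOp_sum Finset.univ hX' hY' hcr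
    rw [D.curvatureOp_congr_of_eventuallyEq hX' hY' hσ hsm, hsum]
    · refine Finset.sum_congr rfl fun i _ ↦ ?_
      rw [D.curvatureOp_smul hX' hY' (hc hσ i) (hr i)]
      rfl
    · filter_upwards [e.eventually_eq_localFrame_sum_coeff_smul (I := I) (s := σ) b hxe] with y hy
      rw [hy, Finset.sum_apply]
      rfl
  rw [hexp hs, hexp ht, hst]

variable [I.Boundaryless] [FiniteDimensional ℝ F] [ContMDiffVectorBundle ∞ F V I]

/-- The endomorphism `R(u, v)` of the fibre at `x`, computed on local extensions of `u`, `v` and of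
the vectors of the fibre. By `curvatureOp_congr` the choice of the extensions is immaterial. -/
def curvatureEnd (D : CovariantDerivative I F V) [ContMDiffCovariantDerivative D ∞] {x : M}
    (u v : TangentSpace I x) : V x →ₗ[ℝ] V x where
  toFun w := D.curvatureOp (extend E u) (extend E v) (extend F w) x
  map_add' := fun w w' ↦ by
    have hw := eventually_contMDiffAt_extend (I := I) (F := F) w
    have hw' := eventually_contMDiffAt_extend (I := I) (F := F) w'
    rw [← D.curvatureOp_add (mdifferentiableAt_extend ..) (mdifferentiableAt_extend ..) hw hw']
    refine D.curvatureOp_congr (mdifferentiableAt_extend ..) (mdifferentiableAt_extend ..)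
      (mdifferentiableAt_extend ..) (mdifferentiableAt_extend ..)
      (eventually_contMDiffAt_extend _) ?_ rfl rfl (by simp)
    filter_upwards [hw, hw'] with y h h' using h.add_section h'
  map_smul' := fun c w ↦ by
    have hw := eventually_contMDiffAt_extend (I := I) (F := F) w
    have hc : ∀ᶠ y in 𝓝 x, CMDiffAt ∞ (fun _ : M ↦ c) y :=
      Filter.Eventually.of_forall fun y ↦ contMDiffAt_const
    have h := D.curvatureOp_smul (mdifferentiableAt_extend I E u)
      (mdifferentiableAt_extend I E v) hc hw
    rw [RingHom.id_apply, ← h]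
    refine D.curvatureOp_congr (mdifferentiableAt_extend ..) (mdifferentiableAt_extend ..)
      (mdifferentiableAt_extend ..) (mdifferentiableAt_extend ..)
      (eventually_contMDiffAt_extend _) ?_ rfl rfl (by simp)
    filter_upwards [hc, hw] with y h h' using h.smul_section h'

theorem curvatureEnd_swap (D : CovariantDerivative I F V) [ContMDiffCovariantDerivative D ∞] {x : M}
    (u v : TangentSpace I x) : D.curvatureEnd v u = - D.curvatureEnd u v :=
  LinearMap.ext fun _ ↦ D.curvatureOp_swap _ _ _ _

theorem curvatureEnd_self (D : CovariantDerivative I F V) [ContMDiffCovariantDerivative D ∞] {x : M}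
    (u : TangentSpace I x) : D.curvatureEnd u u = 0 := by
  ext w
  simp [curvatureEnd, curvatureOp]

theorem curvatureEnd_add_left (D : CovariantDerivative I F V) [ContMDiffCovariantDerivative D ∞]
    {x : M} (u u' v : TangentSpace I x) :
    D.curvatureEnd (u + u') v = D.curvatureEnd u v + D.curvatureEnd u' v := by
  refine LinearMap.ext fun w ↦ ?_
  have hw := eventually_contMDiffAt_extend (I := I) (F := F) w
  refine Eq.trans ?_ (D.curvatureOp_add_left (mdifferentiableAt_extend I E u)
    (mdifferentiableAt_extend I E u') hw)
  exact D.curvatureOp_congr (mdifferentiableAt_extend ..)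
    (mdifferentiableAt_add_section (mdifferentiableAt_extend ..) (mdifferentiableAt_extend ..))
    (mdifferentiableAt_extend ..) (mdifferentiableAt_extend ..) hw hw (by simp) rfl rfl

theorem curvatureEnd_smul_left (D : CovariantDerivative I F V) [ContMDiffCovariantDerivative D ∞]
    {x : M} (c : ℝ) (u v : TangentSpace I x) :
    D.curvatureEnd (c • u) v = c • D.curvatureEnd u v := by
  refine LinearMap.ext fun w ↦ ?_
  have hw := eventually_contMDiffAt_extend (I := I) (F := F) w
  have hc : MDiffAt (fun _ : M ↦ c) x := mdifferentiableAt_const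
  refine Eq.trans ?_ (D.curvatureOp_smul_left hc (mdifferentiableAt_extend I E u) hw)
  exact D.curvatureOp_congr (mdifferentiableAt_extend ..)
    (hc.smul_section (mdifferentiableAt_extend ..))
    (mdifferentiableAt_extend ..) (mdifferentiableAt_extend ..) hw hw (by simp) rfl rfl

/-- The curvature `R` at `x`, a two-form with values in the endomorphisms of the fibre. -/
def curvature (D : CovariantDerivative I F V) [ContMDiffCovariantDerivative D ∞] (x : M) :
    TangentSpace I x [⋀^Fin 2]→ₗ[ℝ] (V x →ₗ[ℝ] V x) where
  toFun m := D.curvatureEnd (m 0) (m 1)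
  map_update_add' := fun m i u v ↦ by
    fin_cases i
    · simpa using D.curvatureEnd_add_left u v (m 1)
    · have h := D.curvatureEnd_add_left u v (m 0)
      rw [D.curvatureEnd_swap (m 0), D.curvatureEnd_swap (m 0) u, D.curvatureEnd_swap (m 0) v,
        ← neg_add, neg_inj] at h
      simpa using h
  map_update_smul' := fun m i c u ↦ by
    fin_cases i
    · simpa using D.curvatureEnd_smul_left c u (m 1)
    · have h := D.curvatureEnd_smul_left c u (m 0)
      rw [D.curvatureEnd_swap (m 0), D.curvatureEnd_swap (m 0) u, smul_neg, neg_inj] at h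
      simpa using h
  map_eq_zero_of_eq' := fun m i j h hij ↦ by
    have h01 : m 0 = m 1 := by
      fin_cases i <;> fin_cases j <;> simp_all
    rw [h01, curvatureEnd_self]

/-- For vector fields `X`, `Y` and a section `s`, smooth near `x`, the curvature is
`R(X, Y) s = D_X D_Y s - D_Y D_X s - D_{[X, Y]} s`. -/
theorem curvature_apply (D : CovariantDerivative I F V) [ContMDiffCovariantDerivative D ∞]
    {X Y : Π y : M, TangentSpace I y} {s : Π y : M, V y} {x : M}
    (hX : MDiffAt (T% X) x) (hY : MDiffAt (T% Y) x)
    (hs : ∀ᶠ y in 𝓝 x, CMDiffAt ∞ (T% s) y) :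
    D.curvature x ![X x, Y x] (s x) =
      D (fun y ↦ D s y (Y y)) x (X x) - D (fun y ↦ D s y (X y)) x (Y x)
        - D s x (mlieBracket I X Y x) :=
  D.curvatureOp_congr (mdifferentiableAt_extend ..) hX (mdifferentiableAt_extend ..) hY
    (eventually_contMDiffAt_extend _) hs (by simp) (by simp) (by simp)

end curvature

section metric

variable {E : Type*} [NormedAddCommGroup E] [NormedSpace ℝ E] [FiniteDimensional ℝ E]
  {H : Type*} [TopologicalSpace H] {I : ModelWithCorners ℝ E H} [I.Boundaryless]
  {M : Type*} [TopologicalSpace M] [T2Space M] [ChartedSpace H M] [IsManifold I ∞ M]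
  {F : Type*} [NormedAddCommGroup F] [NormedSpace ℝ F] [FiniteDimensional ℝ F]
  {V : M → Type*} [TopologicalSpace (TotalSpace F V)]
  [∀ x, NormedAddCommGroup (V x)] [∀ x, InnerProductSpace ℝ (V x)]
  [FiberBundle F V] [VectorBundle ℝ F V] [ContMDiffVectorBundle ∞ F V I]
  [IsContMDiffRiemannianBundle I ∞ F V]

theorem inner_curvature_self (D : CovariantDerivative I F V) [ContMDiffCovariantDerivative D ∞]
    (hD : D.IsMetricCompatible) (x : M) (m : Fin 2 → TangentSpace I x) (v : V x) :
    inner ℝ (D.curvature x m v) v = 0 := by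
  set X : Π y : M, TangentSpace I y := extend E (m 0)
  set Y : Π y : M, TangentSpace I y := extend E (m 1)
  set s : Π y : M, V y := extend F v
  have hX : MDiffAt (T% X) x := mdifferentiableAt_extend ..
  have hY : MDiffAt (T% Y) x := mdifferentiableAt_extend ..
  have hs : ∀ᶠ y in 𝓝 x, CMDiffAt ∞ (T% s) y := eventually_contMDiffAt_extend _
  have hsx : MDiffAt (T% s) x := hs.self_of_nhds.mdifferentiableAt (by simp)
  let f : M → ℝ := fun y ↦ inner ℝ (s y) (s y)
  have hf : ∀ᶠ y in 𝓝 x, CMDiffAt ∞ f y := by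
    filter_upwards [hs] with y hy using hy.inner_bundle hy
  have h1 : ∀ Z : Π y : M, TangentSpace I y, ∀ᶠ y in 𝓝 x,
      (d% f) y (Z y) = inner ℝ (D s y (Z y)) (s y) + inner ℝ (s y) (D s y (Z y)) := by
    intro Z
    filter_upwards [hs] with y hy
    exact hD.mvfderiv_inner_eq (x := y) Z (hy.mdifferentiableAt (by simp))
      (hy.mdifferentiableAt (by simp))
  have h2 : ∀ {Z : Π y : M, TangentSpace I y}, MDiffAt (T% Z) x → ∀ W : Π y : M, TangentSpace I y,
      (d% (fun y ↦ (d% f) y (Z y))) x (W x) =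
        2 * (inner ℝ (D (fun y ↦ D s y (Z y)) x (W x)) (s x)
          + inner ℝ (D s x (Z x)) (D s x (W x))) := by
    intro Z hZ W
    have hDZ : MDiffAt (T% (fun y ↦ D s y (Z y))) x := D.mdifferentiableAt_apply hs hZ
    have e1 := hD.mvfderiv_inner_eq W hDZ hsx
    have e2 := hD.mvfderiv_inner_eq W hsx hDZ
    have e3 := mvfderiv_add (hDZ.inner_bundle hsx) (hsx.inner_bundle hDZ)
    have e4 : (d% (fun y ↦ (d% f) y (Z y))) x = (d% ((fun y ↦ inner ℝ (D s y (Z y)) (s y)) +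
        fun y ↦ inner ℝ (s y) (D s y (Z y)))) x :=
      Filter.EventuallyEq.mfderiv_eq (I := I) (I' := 𝓘(ℝ, ℝ)) (h1 Z)
    rw [e4, e3, _root_.add_apply, e1, e2]
    simp only
    rw [real_inner_comm (s x), real_inner_comm (D s x (W x))]
    ring
  have h3 := mvfderiv_mlieBracket hf hX hY
  rw [(h1 (mlieBracket I X Y)).self_of_nhds, h2 hY X, h2 hX Y,
    real_inner_comm (D s x (X x)) (D s x (Y x)), real_inner_comm (D s x _) (s x)] at h3
  have hv : s x = v := by simp [s]
  have h4 : D.curvature x m v = D.curvatureOp X Y s x := rfl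
  rw [h4, curvatureOp, inner_sub_left, inner_sub_left, ← hv]
  linarith

/-- The curvature as a `(2, 2)`-bi-form, `R(X, Y, s, t) = h(R(X, Y) t, s)`. -/
def curvatureBiForm (D : CovariantDerivative I F V) [ContMDiffCovariantDerivative D ∞]
    (hD : D.IsMetricCompatible) (x : M) : BiForm 2 2 (TangentSpace I x) (V x) where
  toFun m :=
    { toFun := fun w ↦ inner ℝ (D.curvature x m (w 1)) (w 0)
      map_update_add' := fun w i a b ↦ by
        fin_cases i
        · simp [inner_add_right]
        · simp [inner_add_left]
      map_update_smul' := fun w i c a ↦ by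
        fin_cases i
        · simp [inner_smul_right]
        · simp [inner_smul_left]
      map_eq_zero_of_eq' := fun w i j h hij ↦ by
        have h01 : w 1 = w 0 := by
          fin_cases i <;> fin_cases j <;> simp_all
        rw [h01, D.inner_curvature_self hD] }
  map_update_add' := fun m i a b ↦ AlternatingMap.ext fun w ↦ by
    simp [inner_add_left]
  map_update_smul' := fun m i c a ↦ AlternatingMap.ext fun w ↦ by
    simp [inner_smul_left]
  map_eq_zero_of_eq' := fun m i j h hij ↦ AlternatingMap.ext fun w ↦ by
    simp [(D.curvature x).map_eq_zero_of_eq m h hij]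

end metric

end CovariantDerivative

/-! ### Oriented bundles and the Euler form -/

section Bundles

/-- An orientation of a real vector bundle of rank `n`: an orientation of every fibre which is
locally constant in the local trivializations. -/
structure BundleOrientation {M : Type*} [TopologicalSpace M]
    (F : Type*) [NormedAddCommGroup F] [NormedSpace ℝ F]
    (V : M → Type*) [TopologicalSpace (TotalSpace F V)]
    [∀ x, AddCommGroup (V x)] [∀ x, Module ℝ (V x)] [∀ x : M, TopologicalSpace (V x)]
    [FiberBundle F V] [VectorBundle ℝ F V] (n : ℕ) where
  /-- The orientation of the fibre. -/
  fiber (x : M) : Orientation ℝ (V x) (Fin n)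
  locallyConstant (x₀ : M) : ∃ o : Orientation ℝ F (Fin n), ∀ᶠ x in 𝓝 x₀,
    ∀ hx : x ∈ (trivializationAt F V x₀).baseSet,
      Orientation.map (Fin n) ((trivializationAt F V x₀).linearEquivAt ℝ x hx) (fiber x) = o

theorem finrank_fiber {M : Type*} [TopologicalSpace M]
    {F : Type*} [NormedAddCommGroup F] [NormedSpace ℝ F]
    (V : M → Type*) [TopologicalSpace (TotalSpace F V)]
    [∀ x, AddCommGroup (V x)] [∀ x, Module ℝ (V x)] [∀ x : M, TopologicalSpace (V x)]
    [FiberBundle F V] [VectorBundle ℝ F V] {n : ℕ} (hF : Module.finrank ℝ F = n) (x : M) :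
    Module.finrank ℝ (V x) = n :=
  (VectorBundle.continuousLinearEquivAt ℝ F V x).toLinearEquiv.finrank_eq.trans hF

variable {E : Type*} [NormedAddCommGroup E] [NormedSpace ℝ E] [FiniteDimensional ℝ E]
  {H : Type*} [TopologicalSpace H] {I : ModelWithCorners ℝ E H} [I.Boundaryless]
  {M : Type*} [TopologicalSpace M] [T2Space M] [ChartedSpace H M] [IsManifold I ∞ M]
  {F : Type*} [NormedAddCommGroup F] [NormedSpace ℝ F] [FiniteDimensional ℝ F]
  {V : M → Type*} [TopologicalSpace (TotalSpace F V)]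
  [∀ x, NormedAddCommGroup (V x)] [∀ x, InnerProductSpace ℝ (V x)]
  [FiberBundle F V] [VectorBundle ℝ F V] [ContMDiffVectorBundle ∞ F V I]

/-- The entries `R^a_b (X, Y) = s^a (R(X, Y) s_b)` of the matrix of curvature two-forms with respect
to a basis `s` of the fibre with dual basis `s^a`. -/
def curvatureMatrix (D : CovariantDerivative I F V) [D.ContMDiffCovariantDerivative ∞] {x : M}
    {ι : Type*} (s : Module.Basis ι ℝ (V x)) (a b : ι) : Form 2 (TangentSpace I x) :=
  (s.coord a ∘ₗ LinearMap.applyₗ (s b)).compAlternatingMap (D.curvature x)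

/-- The Euler form in terms of the Pfaffian of the curvature matrix of a basis `s` of the fibre,
`((2 π)^{2k} 2^{2k} (2k)!)⁻¹ ∑_σ sign σ • R^{σ(1)}_{σ(2)} ∧ ⋯ ∧ R^{σ(4k-1)}_{σ(4k)}`. -/
def eulerFormOfBasis {k : ℕ} (D : CovariantDerivative I F V) [D.ContMDiffCovariantDerivative ∞]
    {x : M} (s : Module.Basis (Fin (4 * k)) ℝ (V x)) : Form (4 * k) (TangentSpace I x) :=
  (1 / ((2 * Real.pi) ^ (2 * k) * 2 ^ (2 * k) * (2 * k).factorial) : ℝ) •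
    ∑ σ : Equiv.Perm (Fin (4 * k)), Equiv.Perm.sign σ •
      Form.cast (show 2 * (2 * k) = 4 * k by ring) (Form.wedgeProd fun j : Fin (2 * k) ↦
        curvatureMatrix D s (σ ⟨2 * j, by omega⟩) (σ ⟨2 * j + 1, by omega⟩))

/-- The Euler form `e(ξ)` of an oriented metric bundle of rank `4k` with a connection, computed in a
positively oriented orthonormal basis of the fibre. -/
def eulerForm {k : ℕ} (hk : 0 < k) (hF : Module.finrank ℝ F = 4 * k)
    (D : CovariantDerivative I F V) [D.ContMDiffCovariantDerivative ∞]
    (oV : BundleOrientation F V (4 * k)) (x : M) : Form (4 * k) (TangentSpace I x) :=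
  eulerFormOfBasis D
    ((oV.fiber x).finOrthonormalBasis (by omega) (finrank_fiber V hF x)).toBasis

variable [IsContMDiffRiemannianBundle I ∞ F V]
  [RiemannianBundle (fun x : M ↦ TangentSpace I x)]

/-- The volume form `ε` of an oriented Riemannian manifold. -/
def riemannianVolumeForm {n : ℕ} (hE : Module.finrank ℝ E = n)
    (oM : BundleOrientation E (fun x : M ↦ TangentSpace I x) n) (x : M) :
    Form n (TangentSpace I x) :=
  volumeElement (finrank_fiber (fun x : M ↦ TangentSpace I x) hE x) (oM.fiber x)

/-- For signs `a`, `b`, the square of the norm at `x` of the component `(R^k)^a_b` of `R^k`. -/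
def curvaturePowNormSq {k : ℕ} (hE : Module.finrank ℝ E = 4 * k) (hF : Module.finrank ℝ F = 4 * k)
    (oM : BundleOrientation E (fun x : M ↦ TangentSpace I x) (4 * k))
    (oV : BundleOrientation F V (4 * k))
    (D : CovariantDerivative I F V) [D.ContMDiffCovariantDerivative ∞] (hD : D.IsMetricCompatible)
    (a b : ℤˣ) (x : M) : ℝ :=
  haveI : FiniteDimensional ℝ (TangentSpace I x) :=
    VectorBundle.finiteDimensional ℝ E (fun x : M ↦ TangentSpace I x) x
  haveI : FiniteDimensional ℝ (V x) := VectorBundle.finiteDimensional ℝ F V x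
  BiForm.normSq
    (BiForm.leftPart (finrank_fiber (fun x : M ↦ TangentSpace I x) hE x) (oM.fiber x) a
      (BiForm.rightPart (finrank_fiber V hF x) (oV.fiber x) b
        ((D.curvatureBiForm hD x).pow k)))

end Bundles

end

/-! The theorem is pointwise linear algebra in two steps: the Euler form is a value of the bi-form
`R^k ∧ R^k`, and `T ∧ T` is a signed sum of norms for every `T` in `Λ^{2k} ⊗ Λ^{2k}`.

For the first step, a wedge product of forms of degrees `p` and `q`, multiplied by `p! q!`, is a
signed sum over all permutations. Hence `4^p R^p(v, w)` is the sum over pairs of permutations `(σ,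
τ)` of `sign σ sign τ` times the product of the values of `R` on consecutive pairs of permuted
vectors, and `R^p ∧ R^q` has the same expansion with `p + q` in place of `p`
(`BiForm.four_pow_mul_pow_wedge_pow_apply`). The Pfaffian sum in the Euler form, expanded in the
same way, carries only a factor 2 for each two-form, so it equals `2^{2k} (R^k ∧ R^k)(v, s)`
(`BiForm.sum_sign_wedgeProd_apply`). The power of 2 in the normalization cancels, leaving `e(ξ)(v) =
(R^k ∧ R^k)(v, s) / ((2π)^{2k} (2k)!)`.

For the second step, `α ∧ β = (α, *β) ω` on `2k`-forms, so `T ∧ T` is `(T, (* ⊗ *) T)` times the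
product of the two volume elements. Since `* ⊗ *` acts on the component `T^a_b` by the sign `ab`,
this pairing is the alternating sum of the `|T^a_b|^2` (`BiForm.wedge_self_apply_eq`). In
coordinates the star is the matrix of values of the volume element on pairs of complementary basis
tuples, and the identity becomes a polarization (`sum_sq_projections_eq`).

The frame `s` enters the result only through the value of the volume element of the fibre on it,
which is 1 for a positively oriented orthonormal frame. Independence of the frame thus comes with
the formula. -/

noncomputable section

/-! ### Sums over permutations -/

section Permutations

open Equiv

/-- The sign of a permutation as a real number. -/
def permSgn {n : ℕ} : Perm (Fin n) →* ℝ :=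
  (Int.castRingHom ℝ).toMonoidHom.comp ((Units.coeHom ℤ).comp Perm.sign)

theorem permSgn_apply {n : ℕ} (σ : Perm (Fin n)) : permSgn σ = ((Perm.sign σ : ℤ) : ℝ) := rfl

theorem permSgn_mul_self {n : ℕ} (σ : Perm (Fin n)) : permSgn σ * permSgn σ = 1 := by
  rw [permSgn_apply, ← Int.cast_mul, ← Units.val_mul, Int.units_mul_self]
  simp

theorem sign_smul_eq_permSgn_smul {n : ℕ} {N : Type*} [AddCommGroup N] [Module ℝ N]
    (σ : Perm (Fin n)) (x : N) : Perm.sign σ • x = permSgn σ • x := by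
  rw [permSgn_apply, Int.cast_smul_eq_zsmul, Units.smul_def]

theorem AlternatingMap.map_comp_perm {n : ℕ} {V N : Type*} [AddCommGroup V] [Module ℝ V]
    [AddCommGroup N] [Module ℝ N] (η : V [⋀^Fin n]→ₗ[ℝ] N) (v : Fin n → V) (σ : Perm (Fin n)) :
    η (fun i ↦ v (σ i)) = permSgn σ • η v := by
  rw [← sign_smul_eq_permSgn_smul]
  exact η.map_perm v σ

/-- The permutation of `Fin (p + q)` that permutes the first `p` and the last `q` elements. -/
def blockPerm (p q : ℕ) : Perm (Fin p) × Perm (Fin q) →* Perm (Fin (p + q)) :=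
  (finSumFinEquiv.permCongrHom.toMonoidHom).comp (Perm.sumCongrHom (Fin p) (Fin q))

@[simp]
theorem blockPerm_castAdd {p q : ℕ} (a : Perm (Fin p) × Perm (Fin q)) (i : Fin p) :
    blockPerm p q a (Fin.castAdd q i) = Fin.castAdd q (a.1 i) := by
  simp [blockPerm, Perm.sumCongrHom]

@[simp]
theorem blockPerm_natAdd {p q : ℕ} (a : Perm (Fin p) × Perm (Fin q)) (i : Fin q) :
    blockPerm p q a (Fin.natAdd p i) = Fin.natAdd p (a.2 i) := by
  simp [blockPerm, Perm.sumCongrHom]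

@[simp]
theorem permSgn_blockPerm {p q : ℕ} (a : Perm (Fin p) × Perm (Fin q)) :
    permSgn (blockPerm p q a) = permSgn a.1 * permSgn a.2 := by
  have : Perm.sign (blockPerm p q a) = Perm.sign a.1 * Perm.sign a.2 := by
    rw [← Perm.sign_sumCongr]
    exact Perm.sign_permCongr finSumFinEquiv (Perm.sumCongr a.1 a.2)
  simp [permSgn_apply, this]

/-- Averaging over the image of a finite group in the symmetric group does not change an alternating
sum. -/
theorem sum_permSgn_mul_sum {n : ℕ} {K : Type*} [Group K] [Fintype K] (φ : K →* Perm (Fin n))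
    (f : Perm (Fin n) → ℝ) :
    ∑ σ, permSgn σ * ∑ a : K, permSgn (φ a) * f (σ * φ a) =
      Fintype.card K * ∑ σ, permSgn σ * f σ := by
  simp_rw [Finset.mul_sum]
  rw [Finset.sum_comm]
  have : ∀ a : K, ∑ σ, permSgn σ * (permSgn (φ a) * f (σ * φ a)) = ∑ σ, permSgn σ * f σ := by
    intro a
    rw [← Equiv.sum_comp (Equiv.mulRight (φ a)) fun σ ↦ permSgn σ * f σ]
    simp [mul_assoc]
  rw [Finset.sum_congr rfl fun a _ ↦ this a]
  simp [← Finset.mul_sum]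

/-- A sum over all maps `Fin p → Fin n` of a symmetric function that vanishes on maps with repeated
values is `p!` times the sum over the increasing maps. -/
theorem sum_fun_eq_factorial_mul_sum_orderEmbedding {p n : ℕ} (f : (Fin p → Fin n) → ℝ)
    (hf : ∀ (u : Fin p → Fin n) (σ : Perm (Fin p)), f (fun i ↦ u (σ i)) = f u)
    (h0 : ∀ u : Fin p → Fin n, ¬ Function.Injective u → f u = 0) :
    ∑ u, f u = p.factorial * ∑ i : Fin p ↪o Fin n, f i := by
  -- An injective map is an increasing map precomposed with a permutation. The range determines the
  -- increasing map, which gives uniqueness; sorting gives existence.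
  have h1 : ∑ x : (Fin p ↪o Fin n) × Perm (Fin p), f (fun i ↦ x.1 (x.2 i)) = ∑ u, f u := by
    refine Finset.sum_of_injOn (fun (x : (Fin p ↪o Fin n) × Perm (Fin p)) i ↦ x.1 (x.2 i)) ?_
      (by simp) ?_ (by simp)
    · rintro ⟨i, σ⟩ - ⟨j, τ⟩ - hx
      have hx' : (i : Fin p → Fin n) ∘ σ = j ∘ τ := hx
      have hr : Set.range i = Set.range j := by
        rw [← σ.surjective.range_comp i, ← τ.surjective.range_comp j, hx']
      have hij : i = j := by
        apply DFunLike.coe_injective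
        exact (StrictMono.range_inj i.strictMono j.strictMono).1 hr
      subst hij
      simp only [Prod.mk.injEq, true_and]
      ext a
      exact congrArg Fin.val (i.injective (congrFun hx' a))
    · rintro u - hu
      refine h0 u fun hinj ↦ hu ?_
      have hs : StrictMono (u ∘ Tuple.sort u) :=
        (Tuple.monotone_sort u).strictMono_of_injective (hinj.comp (Tuple.sort u).injective)
      refine ⟨(OrderEmbedding.ofStrictMono _ hs, (Tuple.sort u)⁻¹), by simp, ?_⟩
      ext i
      simp
  rw [← h1, Fintype.sum_prod_type]
  simp [hf, Fintype.card_perm, Finset.mul_sum]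

end Permutations

/-! ### Wedge products as alternating sums -/

section Wedge

open Equiv

variable {V W : Type*} [AddCommGroup V] [Module ℝ V] [AddCommGroup W] [Module ℝ W]
  {N₁ N₂ N : Type*} [AddCommGroup N₁] [Module ℝ N₁] [AddCommGroup N₂] [Module ℝ N₂]
  [AddCommGroup N] [Module ℝ N]

/-- Shuffles represent the cosets of the block permutations. The `p! q!` permutations in one coset
give equal terms, because `α` and `β` are alternating. -/
theorem factorial_smul_wedgeWith_apply (m : N₁ →ₗ[ℝ] N₂ →ₗ[ℝ] N) {p q : ℕ}
    (α : V [⋀^Fin p]→ₗ[ℝ] N₁) (β : V [⋀^Fin q]→ₗ[ℝ] N₂) (v : Fin (p + q) → V) :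
    ((p.factorial * q.factorial : ℕ) : ℝ) • wedgeWith m α β v =
      ∑ σ : Perm (Fin (p + q)), permSgn σ • m (α fun i ↦ v (σ (Fin.castAdd q i)))
        (β fun i ↦ v (σ (Fin.natAdd p i))) := by
  have h := congrArg (fun η ↦ TensorProduct.lift m (η (fun i ↦ v (finSumFinEquiv i))))
    (MultilinearMap.domCoprod_alternization_eq α β)
  simp only [MultilinearMap.alternatization_apply, map_sum, Fintype.card_fin,
    AlternatingMap.smul_apply] at h
  rw [Nat.cast_smul_eq_nsmul]
  rw [map_nsmul] at h
  refine Eq.trans ?_ (h.symm.trans ?_)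
  · rfl
  · rw [← Equiv.sum_comp finSumFinEquiv.permCongr]
    refine Finset.sum_congr rfl fun σ _ ↦ ?_
    rw [← sign_smul_eq_permSgn_smul, Perm.sign_permCongr, Units.smul_def, Units.smul_def,
      map_zsmul]
    simp [MultilinearMap.domCoprod_apply]

theorem Form.factorial_mul_wedge_apply {p q : ℕ} (α : Form p V) (β : Form q V)
    (v : Fin (p + q) → V) :
    ((p.factorial * q.factorial : ℕ) : ℝ) * Form.wedge α β v =
      ∑ σ : Perm (Fin (p + q)), permSgn σ * ((α fun i ↦ v (σ (Fin.castAdd q i))) *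
        β fun i ↦ v (σ (Fin.natAdd p i))) :=
  factorial_smul_wedgeWith_apply (LinearMap.mul ℝ ℝ) α β v

theorem BiForm.factorial_mul_wedge_apply {r s r' s' : ℕ} (S : BiForm r s V W)
    (T : BiForm r' s' V W) (v : Fin (r + r') → V) (w : Fin (s + s') → W) :
    ((r.factorial * r'.factorial : ℕ) : ℝ) * (((s.factorial * s'.factorial : ℕ) : ℝ) *
      BiForm.wedge S T v w) =
      ∑ σ : Perm (Fin (r + r')), permSgn σ * ∑ τ : Perm (Fin (s + s')), permSgn τ *
        (S (fun i ↦ v (σ (Fin.castAdd r' i))) (fun i ↦ w (τ (Fin.castAdd s' i))) *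
          T (fun i ↦ v (σ (Fin.natAdd r i))) (fun i ↦ w (τ (Fin.natAdd s i)))) := by
  -- The general formula is used twice: for forms on `V` with values in forms on `W`, then, after
  -- evaluation at `w`, for scalar forms on `W`.
  let evalAt : Form (s + s') W →ₗ[ℝ] ℝ :=
    { toFun := fun η ↦ η w, map_add' := fun _ _ ↦ rfl, map_smul' := fun _ _ ↦ rfl }
  have h := congrArg evalAt
    (factorial_smul_wedgeWith_apply (Form.wedge (V := W) (p := s) (q := s')) S T v)
  simp only [map_sum, map_smul, smul_eq_mul] at h
  simp_rw [← Form.factorial_mul_wedge_apply]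
  rw [mul_left_comm]
  refine (congrArg _ h).trans ?_
  rw [Finset.mul_sum]
  exact Finset.sum_congr rfl fun σ _ ↦ mul_left_comm _ _ _

end Wedge

/-! ### Powers of two-forms and of (2, 2)-bi-forms -/

section Powers

open Equiv

/-- The averaging identity in both variables at once, as bi-forms require: it is applied to `τ` for
each fixed `σ`, then to `σ`. -/
theorem sum_permSgn_mul_sum_permSgn_mul_sum {m n : ℕ} {K L : Type*} [Group K] [Fintype K] [Group L]
    [Fintype L] (φ : K →* Perm (Fin m)) (ψ : L →* Perm (Fin n))
    (f : Perm (Fin m) → Perm (Fin n) → ℝ) :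
    ∑ σ, permSgn σ * ∑ τ, permSgn τ * ∑ a : K, permSgn (φ a) * ∑ b : L, permSgn (ψ b) *
      f (σ * φ a) (τ * ψ b) =
      Fintype.card K * (Fintype.card L * ∑ σ, permSgn σ * ∑ τ, permSgn τ * f σ τ) := by
  have h : ∀ σ : Perm (Fin m), ∑ τ, permSgn τ * ∑ a : K, permSgn (φ a) * ∑ b : L, permSgn (ψ b) *
      f (σ * φ a) (τ * ψ b) = ∑ a : K, permSgn (φ a) *
        (Fintype.card L * ∑ τ, permSgn τ * f (σ * φ a) τ) := by
    intro σ
    simp_rw [← sum_permSgn_mul_sum ψ, Finset.mul_sum]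
    rw [Finset.sum_comm]
    refine Finset.sum_congr rfl fun a _ ↦ Finset.sum_congr rfl fun τ _ ↦
      Finset.sum_congr rfl fun b _ ↦ ?_
    ring
  simp_rw [h]
  rw [sum_permSgn_mul_sum φ fun σ ↦ Fintype.card L * ∑ τ, permSgn τ * f σ τ]
  congr 1
  rw [Finset.mul_sum]
  exact Finset.sum_congr rfl fun σ _ ↦ mul_left_comm _ _ _

theorem permSgn_eq_one_of_subsingleton {n : ℕ} [Subsingleton (Perm (Fin n))] (σ : Perm (Fin n)) :
    permSgn σ = 1 := by
  rw [Subsingleton.elim σ 1, map_one]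

/-- The pair `(v_{2j}, v_{2j + 1})` of consecutive vectors of a tuple. -/
def pairAt {X : Type*} {m : ℕ} (v : Fin (2 * m) → X) (j : Fin m) : Fin 2 → X :=
  ![v ⟨2 * j, by omega⟩, v ⟨2 * j + 1, by omega⟩]

theorem pairAt_castSucc {X : Type*} {m : ℕ} (v : Fin (2 * (m + 1)) → X) (j : Fin m) :
    pairAt v j.castSucc = pairAt (fun i : Fin (2 * m) ↦ v (Fin.castAdd 2 i)) j := rfl

theorem pairAt_last {X : Type*} {m : ℕ} (v : Fin (2 * (m + 1)) → X) :
    pairAt v (Fin.last m) = fun i ↦ v (Fin.natAdd (2 * m) i) := by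
  ext i
  fin_cases i <;> rfl

variable {V W : Type*} [AddCommGroup V] [Module ℝ V] [AddCommGroup W] [Module ℝ W]

/-- Induction on `m`. The wedge with the last two-form brings `(2m)! 2!`. The permutations of the
first `2m` vectors in the inductive expansion are absorbed by averaging, which cancels `(2m)!` and
leaves one factor 2 for each two-form. -/
theorem Form.two_pow_mul_wedgeProd_apply {m : ℕ} (η : Fin m → Form 2 V) (v : Fin (2 * m) → V) :
    2 ^ m * Form.wedgeProd η v =
      ∑ σ : Perm (Fin (2 * m)), permSgn σ * ∏ j, η j (pairAt (fun i ↦ v (σ i)) j) := by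
  induction m with
  | zero =>
    have : Unique (Perm (Fin (2 * 0))) := inferInstanceAs (Unique (Perm (Fin 0)))
    rw [Fintype.sum_unique, permSgn_eq_one_of_subsingleton]
    simp [Form.wedgeProd]
  | succ m ih =>
    have h := Form.factorial_mul_wedge_apply (Form.wedgeProd fun i : Fin m ↦ η i.castSucc)
      (η (Fin.last m)) v
    have hs := sum_permSgn_mul_sum ((blockPerm (2 * m) 2).comp (MonoidHom.inl _ _))
      fun σ ↦ ∏ j, η j (pairAt (fun i ↦ v (σ i)) j)
    simp only [MonoidHom.comp_apply, MonoidHom.inl_apply, permSgn_blockPerm, map_one, mul_one,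
      Fin.prod_univ_castSucc, pairAt_castSucc, pairAt_last, Perm.mul_apply, blockPerm_castAdd,
      blockPerm_natAdd, Perm.one_apply, Fintype.card_perm, Fintype.card_fin, ← mul_assoc,
      ← Finset.sum_mul] at hs
    simp only [mul_assoc] at hs
    simp only [Fin.prod_univ_castSucc, pairAt_castSucc, pairAt_last]
    have h0 : ((2 * m).factorial : ℝ) ≠ 0 := by positivity
    apply mul_left_cancel₀ h0
    refine Eq.trans ?_ hs
    have h2 : ((2 * m).factorial : ℝ) * (2 ^ (m + 1) * Form.wedgeProd η v) = 2 ^ m *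
        ((((2 * m).factorial * Nat.factorial 2 : ℕ) : ℝ) *
          Form.wedge (Form.wedgeProd fun i : Fin m ↦ η i.castSucc) (η (Fin.last m)) v) := by
      rw [show Form.wedgeProd η = Form.wedge (Form.wedgeProd fun i : Fin m ↦ η i.castSucc)
        (η (Fin.last m)) from rfl]
      push_cast [Nat.factorial_two]
      ring
    rw [h2, h, Finset.mul_sum]
    refine Finset.sum_congr rfl fun σ _ ↦ ?_
    rw [← ih (fun i ↦ η i.castSucc) fun i ↦ v (σ (Fin.castAdd 2 i))]
    ring

/-- The same induction with a permutation on each side: every factor `R` contributes a 2 from `V`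
and a 2 from `W`. -/
theorem BiForm.four_pow_mul_pow_apply (R : BiForm 2 2 V W) (p : ℕ) (v : Fin (2 * p) → V)
    (w : Fin (2 * p) → W) :
    4 ^ p * R.pow p v w =
      ∑ σ : Perm (Fin (2 * p)), permSgn σ * ∑ τ : Perm (Fin (2 * p)), permSgn τ *
        ∏ j, R (pairAt (fun i ↦ v (σ i)) j) (pairAt (fun i ↦ w (τ i)) j) := by
  induction p with
  | zero =>
    have : Unique (Perm (Fin (2 * 0))) := inferInstanceAs (Unique (Perm (Fin 0)))
    rw [Fintype.sum_unique, Fintype.sum_unique, permSgn_eq_one_of_subsingleton]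
    simp [BiForm.pow]
  | succ p ih =>
    have h := BiForm.factorial_mul_wedge_apply (R.pow p) R v w
    have hs := sum_permSgn_mul_sum_permSgn_mul_sum
      ((blockPerm (2 * p) 2).comp (MonoidHom.inl _ _))
      ((blockPerm (2 * p) 2).comp (MonoidHom.inl _ _))
      fun σ τ ↦ ∏ j : Fin (p + 1), R (pairAt (fun i ↦ v (σ i)) j) (pairAt (fun i ↦ w (τ i)) j)
    simp only [MonoidHom.comp_apply, MonoidHom.inl_apply, permSgn_blockPerm, map_one, mul_one,
      Fin.prod_univ_castSucc, pairAt_castSucc, pairAt_last, Perm.mul_apply, blockPerm_castAdd,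
      blockPerm_natAdd, Perm.one_apply, Fintype.card_perm, Fintype.card_fin] at hs
    -- The inner sums are the inductive expansion of `R^p` at the permuted vectors; the last factor
    -- is constant in them.
    have hi : ∀ σ τ : Perm (Fin (2 * p + 2)),
        ∑ a : Perm (Fin (2 * p)), permSgn a * ∑ b : Perm (Fin (2 * p)), permSgn b *
          ((∏ j, R (pairAt (fun i ↦ v (σ (Fin.castAdd 2 (a i)))) j)
            (pairAt (fun i ↦ w (τ (Fin.castAdd 2 (b i)))) j)) *
            R (fun i ↦ v (σ (Fin.natAdd (2 * p) i))) (fun i ↦ w (τ (Fin.natAdd (2 * p) i)))) =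
        4 ^ p * (R.pow p (fun i ↦ v (σ (Fin.castAdd 2 i))) (fun i ↦ w (τ (Fin.castAdd 2 i))) *
            R (fun i ↦ v (σ (Fin.natAdd (2 * p) i))) (fun i ↦ w (τ (Fin.natAdd (2 * p) i)))) := by
      intro σ τ
      rw [← mul_assoc, ih]
      simp only [← mul_assoc, ← Finset.sum_mul]
    rw [Finset.sum_congr rfl fun σ _ ↦ congrArg _ (Finset.sum_congr rfl fun τ _ ↦
      congrArg _ (hi σ τ))] at hs
    simp only [mul_left_comm _ ((4 : ℝ) ^ p), ← Finset.mul_sum] at hs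
    simp only [Fin.prod_univ_castSucc, pairAt_castSucc, pairAt_last]
    have h0 : ((2 * p).factorial : ℝ) ≠ 0 := by positivity
    -- The factor `(2p)!` is cancelled once for `V` and once for `W`.
    apply mul_left_cancel₀ h0
    apply mul_left_cancel₀ h0
    refine Eq.trans ?_ hs
    rw [← h, show R.pow (p + 1) = BiForm.wedge (R.pow p) R from rfl]
    push_cast [Nat.factorial_two]
    ring

end Powers

/-! ### The Pfaffian as a value of `R^k ∧ R^k` -/

section Pfaffian

open Equiv

theorem pairAt_natAdd {X : Type*} {p q : ℕ} (u : Fin (2 * p + 2 * q) → X) (j : Fin q) :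
    pairAt (fun i ↦ u (finCongr (mul_add 2 p q) i)) (Fin.natAdd p j) =
      pairAt (fun i ↦ u (Fin.natAdd (2 * p) i)) j := by
  have h : ∀ (a : ℕ) (ha : a < 2 * (p + q)) (b : Fin (2 * q)), a = 2 * p + b →
      finCongr (mul_add 2 p q) ⟨a, ha⟩ = Fin.natAdd (2 * p) b := by
    intro a ha b hb
    ext
    simpa using hb
  simp only [pairAt]
  rw [h (2 * (Fin.natAdd p j : Fin (p + q))) _ ⟨2 * j, by omega⟩ (by simp; ring),
    h (2 * (Fin.natAdd p j : Fin (p + q)) + 1) _ ⟨2 * j + 1, by omega⟩ (by simp; ring)]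

/-- Separates a sum over block permutations on both sides into the expansion of `R^p` and that of
`R^q`. -/
theorem sum_prod_mul_sum_prod {A B C D : Type*} [Fintype A] [Fintype B] [Fintype C] [Fintype D]
    (f : A → ℝ) (g : B → ℝ) (h : C → ℝ) (l : D → ℝ) (P : A → C → ℝ) (Q : B → D → ℝ) :
    ∑ a : A × B, (f a.1 * g a.2) * ∑ c : C × D, (h c.1 * l c.2) * (P a.1 c.1 * Q a.2 c.2) =
      (∑ a, f a * ∑ c, h c * P a c) * ∑ b, g b * ∑ d, l d * Q b d := by
  rw [Finset.sum_mul_sum, Fintype.sum_prod_type]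
  refine Finset.sum_congr rfl fun a _ ↦ Finset.sum_congr rfl fun b _ ↦ ?_
  rw [mul_mul_mul_comm, Finset.sum_mul_sum, Fintype.sum_prod_type]
  refine congrArg _ (Finset.sum_congr rfl fun c _ ↦ Finset.sum_congr rfl fun d _ ↦ ?_)
  ring

variable {V W : Type*} [AddCommGroup V] [Module ℝ V] [AddCommGroup W] [Module ℝ W]

/-- Averaging over `S_{2p} × S_{2q}` on each side merges the expansions of the two powers into one.
This replaces an appeal to associativity of the wedge product. -/
theorem BiForm.four_pow_mul_pow_wedge_pow_apply (R : BiForm 2 2 V W) (p q : ℕ)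
    (v : Fin (2 * p + 2 * q) → V) (w : Fin (2 * p + 2 * q) → W) :
    4 ^ (p + q) * BiForm.wedge (R.pow p) (R.pow q) v w =
      ∑ σ : Perm (Fin (2 * p + 2 * q)), permSgn σ * ∑ τ : Perm (Fin (2 * p + 2 * q)), permSgn τ *
        ∏ j : Fin (p + q), R (pairAt (fun i ↦ v (σ (finCongr (mul_add 2 p q) i))) j)
          (pairAt (fun i ↦ w (τ (finCongr (mul_add 2 p q) i))) j) := by
  have hf : ∀ σ τ : Perm (Fin (2 * p + 2 * q)),
      ∏ j : Fin (p + q), R (pairAt (fun i ↦ v (σ (finCongr (mul_add 2 p q) i))) j)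
          (pairAt (fun i ↦ w (τ (finCongr (mul_add 2 p q) i))) j) =
      (∏ j, R (pairAt (fun i ↦ v (σ (Fin.castAdd (2 * q) i))) j)
          (pairAt (fun i ↦ w (τ (Fin.castAdd (2 * q) i))) j)) *
        ∏ j, R (pairAt (fun i ↦ v (σ (Fin.natAdd (2 * p) i))) j)
          (pairAt (fun i ↦ w (τ (Fin.natAdd (2 * p) i))) j) := by
    intro σ τ
    rw [Fin.prod_univ_add]
    congr 1
    refine Finset.prod_congr rfl fun j _ ↦ ?_
    rw [pairAt_natAdd fun i ↦ v (σ i), pairAt_natAdd fun i ↦ w (τ i)]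
  have h := BiForm.factorial_mul_wedge_apply (R.pow p) (R.pow q) v w
  have hs := sum_permSgn_mul_sum_permSgn_mul_sum (blockPerm (2 * p) (2 * q))
    (blockPerm (2 * p) (2 * q))
    fun σ τ ↦ ∏ j : Fin (p + q), R (pairAt (fun i ↦ v (σ (finCongr (mul_add 2 p q) i))) j)
          (pairAt (fun i ↦ w (τ (finCongr (mul_add 2 p q) i))) j)
  simp only [hf] at hs
  simp only [Perm.mul_apply, blockPerm_castAdd, blockPerm_natAdd, permSgn_blockPerm,
    Fintype.card_prod, Fintype.card_perm, Fintype.card_fin] at hs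
  have hi : ∀ σ τ : Perm (Fin (2 * p + 2 * q)), _ = _ := fun σ τ ↦
    sum_prod_mul_sum_prod (permSgn (n := 2 * p)) (permSgn (n := 2 * q)) permSgn permSgn
      (fun a b ↦ ∏ j, R (pairAt (fun i ↦ v (σ (Fin.castAdd (2 * q) (a i)))) j)
          (pairAt (fun i ↦ w (τ (Fin.castAdd (2 * q) (b i)))) j))
      (fun a b ↦ ∏ j, R (pairAt (fun i ↦ v (σ (Fin.natAdd (2 * p) (a i)))) j)
          (pairAt (fun i ↦ w (τ (Fin.natAdd (2 * p) (b i)))) j))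
  rw [Finset.sum_congr rfl fun σ _ ↦ congrArg _ (Finset.sum_congr rfl fun τ _ ↦
    congrArg _ (hi σ τ))] at hs
  have hp : ∀ σ τ : Perm (Fin (2 * p + 2 * q)), _ = _ := fun σ τ ↦
    (R.four_pow_mul_pow_apply p (fun i ↦ v (σ (Fin.castAdd (2 * q) i)))
      (fun i ↦ w (τ (Fin.castAdd (2 * q) i)))).symm
  have hq : ∀ σ τ : Perm (Fin (2 * p + 2 * q)), _ = _ := fun σ τ ↦
    (R.four_pow_mul_pow_apply q (fun i ↦ v (σ (Fin.natAdd (2 * p) i)))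
      (fun i ↦ w (τ (Fin.natAdd (2 * p) i)))).symm
  simp only [hp, hq, mul_mul_mul_comm ((4 : ℝ) ^ p), ← pow_add] at hs
  simp only [mul_left_comm _ ((4 : ℝ) ^ (p + q)), ← Finset.mul_sum] at hs
  rw [← h] at hs
  simp only [hf]
  have h0 : (((2 * p).factorial * (2 * q).factorial : ℕ) : ℝ) ≠ 0 := by positivity
  apply mul_left_cancel₀ h0
  apply mul_left_cancel₀ h0
  refine Eq.trans ?_ hs
  ring

/-- With free degrees the equations between them can be substituted away; the use below has `n = 4 *
k`, where they cannot. -/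
theorem BiForm.four_pow_mul_pow_wedge_pow_apply_finCongr (R : BiForm 2 2 V W) {p q m n : ℕ}
    (hm : p + q = m) (h₁ : 2 * m = n) (h₂ : 2 * p + 2 * q = n) (v : Fin n → V) (w : Fin n → W) :
    4 ^ m * BiForm.wedge (R.pow p) (R.pow q) (fun i ↦ v (finCongr h₂ i))
        (fun i ↦ w (finCongr h₂ i)) =
      ∑ σ : Perm (Fin n), permSgn σ * ∑ τ : Perm (Fin n), permSgn τ *
        ∏ j : Fin m, R (pairAt (fun i ↦ v (σ (finCongr h₁ i))) j)
          (pairAt (fun i ↦ w (τ (finCongr h₁ i))) j) := by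
  subst hm
  subst h₂
  exact R.four_pow_mul_pow_wedge_pow_apply p q v w

theorem Form.two_pow_mul_cast_wedgeProd_apply {m n : ℕ} (h : 2 * m = n) (η : Fin m → Form 2 V)
    (v : Fin n → V) :
    2 ^ m * Form.cast h (Form.wedgeProd η) v =
      ∑ σ : Perm (Fin n), permSgn σ * ∏ j, η j (pairAt (fun i ↦ v (σ (finCongr h i))) j) := by
  subst h
  exact Form.two_pow_mul_wedgeProd_apply η v

/-- The Pfaffian of a matrix of two-forms is a value of `R^k ∧ R^k`. -/
theorem BiForm.sum_sign_wedgeProd_apply (R : BiForm 2 2 V W) (k : ℕ) (v : Fin (4 * k) → V)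
    (w : Fin (4 * k) → W) (h₁ : 2 * (2 * k) = 4 * k) (h₂ : 2 * k + 2 * k = 4 * k) :
    ∑ τ : Perm (Fin (4 * k)), permSgn τ * Form.cast h₁ (Form.wedgeProd fun j : Fin (2 * k) ↦
        R.flip ![w (τ ⟨2 * j, by omega⟩), w (τ ⟨2 * j + 1, by omega⟩)]) v =
      2 ^ (2 * k) * BiForm.wedge (R.pow k) (R.pow k) (fun i ↦ v (finCongr h₂ i))
        (fun i ↦ w (finCongr h₂ i)) := by
  have h := R.four_pow_mul_pow_wedge_pow_apply_finCongr (two_mul k).symm h₁ h₂ v w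
  have h0 : (2 : ℝ) ^ (2 * k) ≠ 0 := by positivity
  apply mul_left_cancel₀ h0
  -- One factor `2^{2k}` is used up by expanding the products of two-forms on `V`; the other remains
  -- in the statement.
  have h4 : (4 : ℝ) ^ (2 * k) = 2 ^ (2 * k) * 2 ^ (2 * k) := by
    rw [← mul_pow]
    norm_num
  rw [← mul_assoc ((2 : ℝ) ^ (2 * k)) (2 ^ (2 * k)), ← h4, h, Finset.mul_sum]
  simp only [mul_left_comm ((2 : ℝ) ^ (2 * k)), Form.two_pow_mul_cast_wedgeProd_apply,
    Finset.mul_sum]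
  rw [Finset.sum_comm]
  exact Finset.sum_congr rfl fun σ _ ↦ Finset.sum_congr rfl fun τ _ ↦ mul_left_comm _ _ _

end Pfaffian

/-! ### Wedge products and the star operator -/

section Star

open Equiv

section Expansion

variable {V W : Type*} [AddCommGroup V] [Module ℝ V] [AddCommGroup W] [Module ℝ W]

/-- The coordinate form of `α ∧ β = (α, *β) ω`. The factor `Ω(e)` turns signs into values of `Ω`, so
the sum runs over maps rather than permutations and splits into two independent index tuples. -/
theorem sum_permSgn_eq_sum_orderEmbedding {p q n : ℕ} (h : p + q = n) (Ω : Form (p + q) V)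
    (e : Fin n → V) (g : (Fin p → V) → (Fin q → V) → ℝ)
    (hl : ∀ a b (σ : Perm (Fin p)), g (fun i ↦ a (σ i)) b = permSgn σ * g a b)
    (hr : ∀ a b (σ : Perm (Fin q)), g a (fun i ↦ b (σ i)) = permSgn σ * g a b) :
    Ω (fun i ↦ e (finCongr h i)) * ∑ σ : Perm (Fin (p + q)), permSgn σ *
      g (fun i ↦ e (finCongr h (σ (Fin.castAdd q i)))) (fun i ↦ e (finCongr h (σ (Fin.natAdd p i)))) =
    ((p.factorial * q.factorial : ℕ) : ℝ) * ∑ i : Fin p ↪o Fin n, ∑ j : Fin q ↪o Fin n,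
      g (fun a ↦ e (i a)) (fun a ↦ e (j a)) *
        Ω (Fin.append (fun a ↦ e (i a)) (fun a ↦ e (j a))) := by
  subst h
  simp only [finCongr_refl, Equiv.refl_apply]
  set F : (Fin (p + q) → Fin (p + q)) → ℝ := fun u ↦ g (fun i ↦ e (u (Fin.castAdd q i)))
    (fun i ↦ e (u (Fin.natAdd p i))) * Ω (fun i ↦ e (u i)) with hF
  -- The maps that are not permutations repeat an index, and `Ω` vanishes there.
  have h1 : ∑ σ : Perm (Fin (p + q)), F σ = ∑ u, F u := by
    refine Finset.sum_of_injOn (fun σ : Perm (Fin (p + q)) ↦ ⇑σ) ?_ (by simp) ?_ (by simp)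
    · exact DFunLike.coe_injective.injOn
    · rintro u - hu
      simp only [hF]
      rw [Ω.map_eq_zero_of_not_injective, mul_zero]
      intro hinj
      have hu' : Function.Injective u := fun a b hab ↦ hinj (by simp [hab])
      exact hu ⟨Equiv.ofBijective u (Finite.injective_iff_bijective.1 hu'), by simp, rfl⟩
  have h2 : ∑ u, F u = ∑ x : Fin p → Fin (p + q), ∑ y : Fin q → Fin (p + q),
      g (fun a ↦ e (x a)) (fun a ↦ e (y a)) *
        Ω (Fin.append (fun a ↦ e (x a)) (fun a ↦ e (y a))) := by
    rw [← Equiv.sum_comp (Fin.appendEquiv p q), Fintype.sum_prod_type]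
    refine Finset.sum_congr rfl fun x _ ↦ Finset.sum_congr rfl fun y _ ↦ ?_
    simp only [hF, Fin.appendEquiv, Equiv.coe_fn_mk, Fin.append_left, Fin.append_right]
    congr 2
    ext i
    refine Fin.addCases (fun i ↦ ?_) (fun i ↦ ?_) i <;> simp
  have hΩl : ∀ (a : Fin p → V) (b : Fin q → V) (σ : Perm (Fin p)),
      Ω (Fin.append (fun i ↦ a (σ i)) b) = permSgn σ * Ω (Fin.append a b) := by
    intro a b σ
    have := Ω.map_comp_perm (Fin.append a b) (blockPerm p q (σ, 1))
    rw [permSgn_blockPerm, map_one, mul_one] at this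
    rw [← smul_eq_mul, ← this]
    congr 1
    ext i
    refine Fin.addCases (fun i ↦ ?_) (fun i ↦ ?_) i <;> simp
  have hΩr : ∀ (a : Fin p → V) (b : Fin q → V) (σ : Perm (Fin q)),
      Ω (Fin.append a (fun i ↦ b (σ i))) = permSgn σ * Ω (Fin.append a b) := by
    intro a b σ
    have := Ω.map_comp_perm (Fin.append a b) (blockPerm p q (1, σ))
    rw [permSgn_blockPerm, map_one, one_mul] at this
    rw [← smul_eq_mul, ← this]
    congr 1
    ext i
    refine Fin.addCases (fun i ↦ ?_) (fun i ↦ ?_) i <;> simp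
  -- Reordering `y` changes `g` and `Ω` by the same sign, so the product is symmetric and increasing
  -- tuples suffice; `h4` does the same for `x`.
  have h3 : ∀ x : Fin p → Fin (p + q), ∑ y : Fin q → Fin (p + q),
      g (fun a ↦ e (x a)) (fun a ↦ e (y a)) *
        Ω (Fin.append (fun a ↦ e (x a)) (fun a ↦ e (y a))) =
      q.factorial * ∑ j : Fin q ↪o Fin (p + q), g (fun a ↦ e (x a)) (fun a ↦ e (j a)) *
        Ω (Fin.append (fun a ↦ e (x a)) (fun a ↦ e (j a))) := by
    intro x
    apply sum_fun_eq_factorial_mul_sum_orderEmbedding fun y ↦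
      g (fun a ↦ e (x a)) (fun a ↦ e (y a)) *
        Ω (Fin.append (fun a ↦ e (x a)) (fun a ↦ e (y a)))
    · intro u σ
      have := hΩr (fun a ↦ e (x a)) (fun a ↦ e (u a)) σ
      rw [this, hr _ (fun a ↦ e (u a)) σ, mul_mul_mul_comm, permSgn_mul_self, one_mul]
    · intro u hu
      obtain ⟨a, b, hab, hne⟩ : ∃ a b, u a = u b ∧ a ≠ b := by
        simpa [Function.Injective] using hu
      rw [Ω.map_eq_zero_of_eq _ (i := Fin.natAdd p a) (j := Fin.natAdd p b) (by simp [hab])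
        (by simpa using hne), mul_zero]
  have h4 := sum_fun_eq_factorial_mul_sum_orderEmbedding (fun x : Fin p → Fin (p + q) ↦
      ∑ j : Fin q ↪o Fin (p + q), g (fun a ↦ e (x a)) (fun a ↦ e (j a)) *
        Ω (Fin.append (fun a ↦ e (x a)) (fun a ↦ e (j a)))) (by
      intro u σ
      refine Finset.sum_congr rfl fun j _ ↦ ?_
      have := hΩl (fun a ↦ e (u a)) (fun a ↦ e (j a)) σ
      rw [this, hl (fun a ↦ e (u a)) _ σ, mul_mul_mul_comm, permSgn_mul_self, one_mul]) (by
      intro u hu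
      obtain ⟨a, b, hab, hne⟩ : ∃ a b, u a = u b ∧ a ≠ b := by
        simpa [Function.Injective] using hu
      refine Finset.sum_eq_zero fun j _ ↦ ?_
      rw [Ω.map_eq_zero_of_eq _ (i := Fin.castAdd q a) (j := Fin.castAdd q b) (by simp [hab])
        (by simpa using hne), mul_zero])
  have h5 : ∑ σ : Perm (Fin (p + q)), F σ = ((p.factorial * q.factorial : ℕ) : ℝ) *
      ∑ i : Fin p ↪o Fin (p + q), ∑ j : Fin q ↪o Fin (p + q),
      g (fun a ↦ e (i a)) (fun a ↦ e (j a)) *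
        Ω (Fin.append (fun a ↦ e (i a)) (fun a ↦ e (j a))) := by
    rw [h1, h2, Finset.sum_congr rfl fun x _ ↦ h3 x, ← Finset.mul_sum, h4]
    push_cast
    ring
  -- Here `sign σ` times `Ω(e)` is the value of `Ω` on the permuted tuple.
  rw [← h5, Finset.mul_sum]
  refine Finset.sum_congr rfl fun σ _ ↦ ?_
  have := Ω.map_comp_perm e σ
  simp only [hF]
  rw [this, smul_eq_mul]
  ring

theorem BiForm.wedge_apply_eq_sum_orderEmbedding {p q m n : ℕ} (hm : p + q = m) (hn : p + q = n)
    (S : BiForm p p V W) (T : BiForm q q V W) (Ω : Form (p + q) V) (Θ : Form (p + q) W)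
    (e : Fin m → V) (f : Fin n → W) :
    Ω (fun i ↦ e (finCongr hm i)) * (Θ (fun i ↦ f (finCongr hn i)) *
      BiForm.wedge S T (fun i ↦ e (finCongr hm i)) (fun i ↦ f (finCongr hn i))) =
    ∑ i : Fin p ↪o Fin m, ∑ i' : Fin q ↪o Fin m, ∑ j : Fin p ↪o Fin n, ∑ j' : Fin q ↪o Fin n,
      S (fun a ↦ e (i a)) (fun a ↦ f (j a)) * T (fun a ↦ e (i' a)) (fun a ↦ f (j' a)) *
        (Ω (Fin.append (fun a ↦ e (i a)) (fun a ↦ e (i' a))) *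
          Θ (Fin.append (fun a ↦ f (j a)) (fun a ↦ f (j' a)))) := by
  set C : ℝ := ((p.factorial * q.factorial : ℕ) : ℝ)
  have h0 : C ≠ 0 := by positivity
  have h := BiForm.factorial_mul_wedge_apply S T (fun i ↦ e (finCongr hm i))
    (fun i ↦ f (finCongr hn i))
  -- The expansion is made in `W` for fixed arguments from `V`. The resulting sum is alternating in
  -- each of these arguments and serves as `g` for the expansion in `V`.
  have hW : ∀ a b, _ = _ := fun a b ↦ sum_permSgn_eq_sum_orderEmbedding hn Θ f
    (fun c d ↦ S a c * T b d)
    (fun c d σ ↦ by rw [(S a).map_comp_perm, smul_eq_mul, mul_assoc])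
    (fun c d σ ↦ by rw [(T b).map_comp_perm, smul_eq_mul, mul_left_comm])
  have hV := sum_permSgn_eq_sum_orderEmbedding hm Ω e
    (fun a b ↦ ∑ j : Fin p ↪o Fin n, ∑ j' : Fin q ↪o Fin n, S a (fun a ↦ f (j a)) *
      T b (fun a ↦ f (j' a)) * Θ (Fin.append (fun a ↦ f (j a)) (fun a ↦ f (j' a))))
    (fun c d σ ↦ by
      simp only [S.map_comp_perm, AlternatingMap.smul_apply, smul_eq_mul, Finset.mul_sum,
        mul_assoc])
    (fun c d σ ↦ by
      simp only [T.map_comp_perm, AlternatingMap.smul_apply, smul_eq_mul, Finset.mul_sum,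
        mul_assoc, mul_left_comm (permSgn σ)])
  apply mul_left_cancel₀ h0
  apply mul_left_cancel₀ h0
  calc _ = Ω (fun i ↦ e (finCongr hm i)) * (Θ (fun i ↦ f (finCongr hn i)) *
        (C * (C * BiForm.wedge S T (fun i ↦ e (finCongr hm i)) (fun i ↦ f (finCongr hn i))))) := by
        ring
    _ = C * (Ω (fun i ↦ e (finCongr hm i)) * ∑ σ : Perm (Fin (p + q)), permSgn σ *
          ∑ j : Fin p ↪o Fin n, ∑ j' : Fin q ↪o Fin n,
            S (fun i ↦ e (finCongr hm (σ (Fin.castAdd q i)))) (fun a ↦ f (j a)) *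
            T (fun i ↦ e (finCongr hm (σ (Fin.natAdd p i)))) (fun a ↦ f (j' a)) *
            Θ (Fin.append (fun a ↦ f (j a)) (fun a ↦ f (j' a)))) := by
        rw [h, Finset.mul_sum, mul_left_comm C]
        congr 1
        rw [Finset.mul_sum]
        refine Finset.sum_congr rfl fun σ _ ↦ ?_
        rw [mul_left_comm, hW, mul_left_comm]
    _ = _ := by
        rw [hV]
        congr 2
        refine Finset.sum_congr rfl fun i _ ↦ Finset.sum_congr rfl fun i' _ ↦ ?_
        rw [Finset.sum_mul]
        refine Finset.sum_congr rfl fun j _ ↦ ?_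
        rw [Finset.sum_mul]
        exact Finset.sum_congr rfl fun j' _ ↦ by ring

end Expansion
end Star

/-! ### Norms of the self-dual and anti-self-dual components -/

section Norm

open Equiv

/-- Here `A` and `B` are the matrices of the two star operators and `P a b` is `(1 + aA)(1 + bB) t /
4`. Polarization and the symmetry of `B` suffice; neither `A² = 1` nor `B² = 1` is needed. -/
theorem sum_sq_projections_eq {ι κ : Type*} [Fintype ι] [Fintype κ] (t : ι → κ → ℝ)
    (A : ι → ι → ℝ) (B : κ → κ → ℝ) (hB : ∀ j j', B j j' = B j' j) (r : ℝ → ι → κ → ℝ)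
    (P : ℝ → ℝ → ι → κ → ℝ)
    (hr : ∀ b i j, r b i j = 1 / 2 * (t i j + b * ∑ j', t i j' * B j' j))
    (hP : ∀ a b i j, P a b i j = 1 / 2 * (r b i j + a * ∑ i', r b i' j * A i' i)) :
    ∑ i, ∑ j, P 1 1 i j ^ 2 - ∑ i, ∑ j, P 1 (-1) i j ^ 2 - ∑ i, ∑ j, P (-1) 1 i j ^ 2
      + ∑ i, ∑ j, P (-1) (-1) i j ^ 2 =
    ∑ i, ∑ i', ∑ j, ∑ j', t i j * t i' j' * (A i i' * B j j') := by
  have hPx : ∀ a b i j, P a b i j = 1 / 4 * (t i j + b * (∑ j', t i j' * B j' j) +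
      a * (∑ i', t i' j * A i' i) + a * b * ∑ i', (∑ j', t i' j' * B j' j) * A i' i) := by
    intro a b i j
    have : ∑ i', r b i' j * A i' i = 1 / 2 * (∑ i', t i' j * A i' i) +
        1 / 2 * b * ∑ i', (∑ j', t i' j' * B j' j) * A i' i := by
      rw [Finset.mul_sum, Finset.mul_sum, ← Finset.sum_add_distrib]
      exact Finset.sum_congr rfl fun i' _ ↦ by rw [hr]; ring
    rw [hP, this, hr]
    ring
  -- Weighting by `ab` and summing over the signs keeps only the products `t · ABt` and `Bt · At`,
  -- each with coefficient `4 · 2 / 16`.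
  have h1 : ∑ i, ∑ j, P 1 1 i j ^ 2 - ∑ i, ∑ j, P 1 (-1) i j ^ 2 - ∑ i, ∑ j, P (-1) 1 i j ^ 2
      + ∑ i, ∑ j, P (-1) (-1) i j ^ 2 =
      1 / 2 * (∑ i, ∑ j, t i j * ∑ i', (∑ j', t i' j' * B j' j) * A i' i) +
      1 / 2 * ∑ i, ∑ j, (∑ j', t i j' * B j' j) * (∑ i', t i' j * A i' i) := by
    simp only [Finset.mul_sum (s := (Finset.univ : Finset ι)) (a := (1 / 2 : ℝ)),
      Finset.mul_sum (s := (Finset.univ : Finset κ)) (a := (1 / 2 : ℝ))]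
    simp only [← Finset.sum_sub_distrib, ← Finset.sum_add_distrib]
    refine Finset.sum_congr rfl fun i _ ↦ Finset.sum_congr rfl fun j _ ↦ ?_
    rw [hPx, hPx, hPx, hPx]
    ring
  have h2 : ∑ i, ∑ j, t i j * ∑ i', (∑ j', t i' j' * B j' j) * A i' i =
      ∑ i, ∑ i', ∑ j, ∑ j', t i j * t i' j' * (A i i' * B j j') := by
    rw [Finset.sum_comm (f := fun i i' ↦ ∑ j, ∑ j', t i j * t i' j' * (A i i' * B j j'))]
    refine Finset.sum_congr rfl fun i _ ↦ ?_
    rw [Finset.sum_congr rfl fun i' _ ↦ Finset.sum_comm, Finset.sum_comm]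
    refine Finset.sum_congr rfl fun j _ ↦ ?_
    rw [Finset.mul_sum]
    refine Finset.sum_congr rfl fun i' _ ↦ ?_
    rw [Finset.sum_mul, Finset.mul_sum]
    exact Finset.sum_congr rfl fun j' _ ↦ by ring
  -- Symmetry moves `B` to the other side: `Bt · At = t · ABt`.
  have h3 : ∑ i, ∑ j, (∑ j', t i j' * B j' j) * (∑ i', t i' j * A i' i) =
      ∑ i, ∑ i', ∑ j, ∑ j', t i j * t i' j' * (A i i' * B j j') := by
    rw [Finset.sum_comm (f := fun i i' ↦ ∑ j, ∑ j', t i j * t i' j' * (A i i' * B j j'))]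
    refine Finset.sum_congr rfl fun i _ ↦ ?_
    rw [Finset.sum_comm (f := fun i' i'' ↦ ∑ j', t i' i'' * t i j' * (A i' i * B i'' j'))]
    refine Finset.sum_congr rfl fun j _ ↦ ?_
    rw [Finset.sum_mul_sum, Finset.sum_comm]
    refine Finset.sum_congr rfl fun i' _ ↦ Finset.sum_congr rfl fun j' _ ↦ ?_
    rw [hB j j']
    ring
  rw [h1, h2, h3]
  ring

/-- Exchanging two copies of `α` is one transposition for each element of `α`. -/
theorem sign_sumComm (α : Type*) [Fintype α] [DecidableEq α] :
    Perm.sign (Equiv.sumComm α α : Perm (α ⊕ α)) = (-1) ^ Fintype.card α := by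
  let φ : α ⊕ α ≃ α × Bool := (Equiv.boolProdEquivSum α).symm.trans (Equiv.prodComm _ _)
  have h : φ.permCongr (Equiv.sumComm α α) =
      Equiv.prodCongrRight fun _ : α ↦ (Equiv.swap false true : Perm Bool) := by
    ext ⟨a, b⟩ <;> cases b <;> rfl
  rw [← Perm.sign_permCongr φ, h, Perm.sign_prodCongrRight]
  simp

/-- Interchanging the two blocks has sign `(-1)^p`. This makes the matrix of the star operator on
`2k`-forms symmetric. -/
theorem Form.apply_append_comm {V : Type*} [AddCommGroup V] [Module ℝ V] {p : ℕ} (hp : Even p)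
    (Ω : Form (p + p) V) (a b : Fin p → V) : Ω (Fin.append a b) = Ω (Fin.append b a) := by
  have h : Fin.append b a =
      fun i ↦ Fin.append a b (finSumFinEquiv.permCongr (Equiv.sumComm _ _) i) := by
    ext i
    refine Fin.addCases (fun i ↦ ?_) (fun i ↦ ?_) i <;> simp [-Fin.natAdd_eq_addNat]
  rw [h, Ω.map_comp_perm, permSgn_apply, Perm.sign_permCongr, sign_sumComm, Fintype.card_fin,
    hp.neg_one_pow]
  simp

/-! ### Volume elements and forms of top degree -/

section Volume

variable {V : Type*} [NormedAddCommGroup V] [InnerProductSpace ℝ V]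

/-- The volume element takes the value `1` or `-1` on an orthonormal basis. -/
theorem volumeElement_apply_mul_self {n : ℕ} (hV : Module.finrank ℝ V = n)
    (o : Orientation ℝ V (Fin n)) (b : OrthonormalBasis (Fin n) ℝ V) :
    volumeElement hV o b * volumeElement hV o b = 1 := by
  have : Fact (Module.finrank ℝ V = n) := ⟨hV⟩
  have h : |o.volumeForm b| = 1 := o.abs_volumeForm_apply_of_orthonormal b
  have h2 := abs_mul_abs_self (o.volumeForm b)
  rw [h] at h2
  exact h2.symm.trans (one_mul 1)

theorem volumeElement_apply_of_orientation_eq {n : ℕ} (hV : Module.finrank ℝ V = n)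
    (o : Orientation ℝ V (Fin n)) (b : OrthonormalBasis (Fin n) ℝ V)
    (hb : b.toBasis.orientation = o) : volumeElement hV o b = 1 := by
  have : Fact (Module.finrank ℝ V = n) := ⟨hV⟩
  have h : o.volumeForm b = 1 := by
    rw [o.volumeForm_robust b hb]
    simpa using b.toBasis.det_self
  exact h

/-- Forms of top degree are multiples of the volume element. -/
theorem Form.apply_eq_mul_volumeElement {n : ℕ} (hV : Module.finrank ℝ V = n)
    (o : Orientation ℝ V (Fin n)) (b : OrthonormalBasis (Fin n) ℝ V) (η : Form n V)
    (v : Fin n → V) : η v = (volumeElement hV o b * η b) * volumeElement hV o v := by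
  -- Both forms are multiples of the determinant of `b`. The basis may be negatively oriented, but
  -- the volume element is `±1` on it and hence its own inverse.
  suffices h : η = (volumeElement hV o b * η b) • volumeElement hV o from
    congrArg (fun ζ : Form n V ↦ ζ v) h
  have hη := η.eq_smul_basis_det b.toBasis
  have hω := (volumeElement hV o).eq_smul_basis_det b.toBasis
  simp only [OrthonormalBasis.coe_toBasis] at hη hω
  nth_rw 2 [hω]
  nth_rw 1 [hη]
  rw [smul_smul, mul_right_comm, volumeElement_apply_mul_self, one_mul]

end Volume

variable {V W : Type*} [NormedAddCommGroup V] [InnerProductSpace ℝ V] [NormedAddCommGroup W]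
  [InnerProductSpace ℝ W]

theorem Form.star_apply [FiniteDimensional ℝ V] {n p q : ℕ} (hV : Module.finrank ℝ V = n)
    (o : Orientation ℝ V (Fin n))
    (h : p + q = n) (β : Form p V) (v : Fin q → V) :
    Form.star hV o h β v = ∑ i : Fin p ↪o Fin (Module.finrank ℝ V), β (basisTuple V i) *
      Form.cast h.symm (volumeElement hV o) (Fin.append (basisTuple V i) v) := by
  let evalAt : Form q V →ₗ[ℝ] ℝ :=
    { toFun := fun η ↦ η v, map_add' := fun _ _ ↦ rfl, map_smul' := fun _ _ ↦ rfl }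
  change evalAt (∑ i : Fin p ↪o Fin (Module.finrank ℝ V), _) = _
  rw [map_sum]
  rfl

theorem BiForm.rightPart_apply [FiniteDimensional ℝ W] {k r : ℕ}
    (hW : Module.finrank ℝ W = 4 * k)
    (o : Orientation ℝ W (Fin (4 * k))) (a : ℤˣ) (T : BiForm r (2 * k) V W) (v : Fin r → V)
    (w : Fin (2 * k) → W) :
    BiForm.rightPart hW o a T v w = 1 / 2 * (T v w + ((a : ℤ) : ℝ) *
      ∑ j : Fin (2 * k) ↪o Fin (Module.finrank ℝ W), T v (basisTuple W j) *
        Form.cast (show 2 * k + 2 * k = 4 * k by ring).symm (volumeElement hW o)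
          (Fin.append (basisTuple W j) w)) := by
  rw [← Form.star_apply hW o (show 2 * k + 2 * k = 4 * k by ring) (T v),
    ← smul_eq_mul ((a : ℤ) : ℝ), Int.cast_smul_eq_zsmul]
  rfl

theorem BiForm.leftPart_apply [FiniteDimensional ℝ V] {k s : ℕ}
    (hV : Module.finrank ℝ V = 4 * k)
    (o : Orientation ℝ V (Fin (4 * k))) (a : ℤˣ) (T : BiForm (2 * k) s V W) (v : Fin (2 * k) → V)
    (w : Fin s → W) :
    BiForm.leftPart hV o a T v w = 1 / 2 * (T v w + ((a : ℤ) : ℝ) *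
      ∑ i : Fin (2 * k) ↪o Fin (Module.finrank ℝ V), T (basisTuple V i) w *
        Form.cast (show 2 * k + 2 * k = 4 * k by ring).symm (volumeElement hV o)
          (Fin.append (basisTuple V i) v)) := by
  have h := Form.star_apply hV o (show 2 * k + 2 * k = 4 * k by ring) (T.flip w) v
  rw [show (∑ i : Fin (2 * k) ↪o Fin (Module.finrank ℝ V), T (basisTuple V i) w *
        Form.cast (show 2 * k + 2 * k = 4 * k by ring).symm (volumeElement hV o)
          (Fin.append (basisTuple V i) v)) = _ from h.symm,
    ← smul_eq_mul ((a : ℤ) : ℝ), Int.cast_smul_eq_zsmul]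
  rfl

/-- For `T` in `Λ^{2k} ⊗ Λ^{2k}`, the wedge product `T ∧ T` is the alternating sum of the squared
norms of the four components of `T`, times the volume elements. -/
theorem BiForm.wedge_self_apply_eq [FiniteDimensional ℝ V] [FiniteDimensional ℝ W] {k : ℕ}
    (hV : Module.finrank ℝ V = 4 * k)
    (hW : Module.finrank ℝ W = 4 * k) (oV : Orientation ℝ V (Fin (4 * k)))
    (oW : Orientation ℝ W (Fin (4 * k))) (T : BiForm (2 * k) (2 * k) V W)
    (h : 2 * k + 2 * k = 4 * k) (v : Fin (4 * k) → V) (w : Fin (4 * k) → W) :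
    BiForm.wedge T T (fun i ↦ v (finCongr h i)) (fun i ↦ w (finCongr h i)) =
      (((T.rightPart hW oW 1).leftPart hV oV 1).normSq
        - ((T.rightPart hW oW (-1)).leftPart hV oV 1).normSq
        - ((T.rightPart hW oW 1).leftPart hV oV (-1)).normSq
        + ((T.rightPart hW oW (-1)).leftPart hV oV (-1)).normSq) *
      (volumeElement hV oV v * volumeElement hW oW w) := by
  -- The volume elements take tuples indexed by `Fin (4 * k)`, whereas the standard bases are
  -- indexed by the `finrank`.
  set e := (stdOrthonormalBasis ℝ V).reindex (finCongr hV)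
  set f := (stdOrthonormalBasis ℝ W).reindex (finCongr hW)
  have hsum := sum_sq_projections_eq
    (fun (i : Fin (2 * k) ↪o Fin (Module.finrank ℝ V))
      (j : Fin (2 * k) ↪o Fin (Module.finrank ℝ W)) ↦ T (basisTuple V i) (basisTuple W j))
    (fun i i' ↦ Form.cast h.symm (volumeElement hV oV)
      (Fin.append (basisTuple V i) (basisTuple V i')))
    (fun j j' ↦ Form.cast h.symm (volumeElement hW oW)
      (Fin.append (basisTuple W j) (basisTuple W j')))
    (fun j j' ↦ Form.apply_append_comm (even_two_mul k) _ _ _)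
    -- The projections `r` and `P` are left to unification, which reads them off their defining
    -- equations.
    _ _ (fun _ _ _ ↦ rfl) (fun _ _ _ _ ↦ rfl)
  have hexp := BiForm.wedge_apply_eq_sum_orderEmbedding (h.trans hV.symm) (h.trans hW.symm) T T
    (Form.cast h.symm (volumeElement hV oV)) (Form.cast h.symm (volumeElement hW oW))
    (stdOrthonormalBasis ℝ V) (stdOrthonormalBasis ℝ W)
  have hN : ((T.rightPart hW oW 1).leftPart hV oV 1).normSq
        - ((T.rightPart hW oW (-1)).leftPart hV oV 1).normSq
        - ((T.rightPart hW oW 1).leftPart hV oV (-1)).normSq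
        + ((T.rightPart hW oW (-1)).leftPart hV oV (-1)).normSq =
      volumeElement hV oV e * (volumeElement hW oW f *
        BiForm.wedge T T (fun i ↦ e (finCongr h i)) (fun i ↦ f (finCongr h i))) := by
    refine Eq.trans ?_ (hsum.trans ?_)
    · simp only [BiForm.normSq, BiForm.leftPart_apply, BiForm.rightPart_apply]
      simp
    · refine hexp.symm.trans ?_
      have he : ∀ i, stdOrthonormalBasis ℝ V (finCongr (h.trans hV.symm) i) = e (finCongr h i) := by
        intro i
        simp [e]
      have hf : ∀ i, stdOrthonormalBasis ℝ W (finCongr (h.trans hW.symm) i) = f (finCongr h i) := by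
        intro i
        simp [f]
      simp only [he, hf]
      rfl
  rw [hN]
  -- `T ∧ T` has top degree in each slot, so the passage from `(e, f)` to `(v, w)` is made one slot
  -- at a time.
  have hv := Form.apply_eq_mul_volumeElement hV oV e
    (Form.cast h (BiForm.flip (BiForm.wedge T T) (fun i ↦ w (finCongr h i)))) v
  have hw := Form.apply_eq_mul_volumeElement hW oW f
    (Form.cast h (BiForm.wedge T T (fun i ↦ e (finCongr h i)))) w
  refine hv.trans ?_
  refine (congrArg (fun x ↦ volumeElement hV oV e * x * volumeElement hV oV v) hw).trans ?_
  simp only [Form.cast, AlternatingMap.domDomCongr_apply, Function.comp_def]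
  ring

end Norm

/-! ### The Euler form -/

section Euler

variable {E : Type*} [NormedAddCommGroup E] [NormedSpace ℝ E] [FiniteDimensional ℝ E]
  {H : Type*} [TopologicalSpace H] {I : ModelWithCorners ℝ E H} [I.Boundaryless]
  {M : Type*} [TopologicalSpace M] [T2Space M] [ChartedSpace H M] [IsManifold I ∞ M]
  {F : Type*} [NormedAddCommGroup F] [NormedSpace ℝ F] [FiniteDimensional ℝ F]
  {V : M → Type*} [TopologicalSpace (TotalSpace F V)]
  [∀ x, NormedAddCommGroup (V x)] [∀ x, InnerProductSpace ℝ (V x)]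
  [FiberBundle F V] [VectorBundle ℝ F V] [ContMDiffVectorBundle ∞ F V I]
  [IsContMDiffRiemannianBundle I ∞ F V]

/-- In an orthonormal frame the dual frame is given by inner products, and the order of arguments in
`R(X, Y, s, t) = h(R(X, Y) t, s)` makes the signs agree. -/
theorem curvatureMatrix_eq_flip_curvatureBiForm (D : CovariantDerivative I F V)
    [D.ContMDiffCovariantDerivative ∞] (hD : D.IsMetricCompatible) {x : M} {ι : Type*} [Fintype ι]
    (s : OrthonormalBasis ι ℝ (V x)) (a b : ι) :
    curvatureMatrix D s.toBasis a b = (D.curvatureBiForm hD x).flip ![s a, s b] := by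
  ext m
  change s.toBasis.repr (D.curvature x m (s.toBasis b)) a = inner ℝ (D.curvature x m (s b)) (s a)
  rw [OrthonormalBasis.coe_toBasis, OrthonormalBasis.coe_toBasis_repr_apply,
    OrthonormalBasis.repr_apply_apply, real_inner_comm]

/-- The `2^{2k}` in the normalization of the Euler form cancels the one in the Pfaffian identity. -/
theorem eulerFormOfBasis_apply {k : ℕ} (D : CovariantDerivative I F V)
    [D.ContMDiffCovariantDerivative ∞] (hD : D.IsMetricCompatible) {x : M}
    (s : OrthonormalBasis (Fin (4 * k)) ℝ (V x)) (h : 2 * k + 2 * k = 4 * k)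
    (v : Fin (4 * k) → TangentSpace I x) :
    eulerFormOfBasis D s.toBasis v = 1 / ((2 * Real.pi) ^ (2 * k) * (2 * k).factorial) *
      BiForm.wedge ((D.curvatureBiForm hD x).pow k) ((D.curvatureBiForm hD x).pow k)
        (fun i ↦ v (finCongr h i)) (fun i ↦ s (finCongr h i)) := by
  have hs := (D.curvatureBiForm hD x).sum_sign_wedgeProd_apply k v s (by ring) h
  let evalAt : Form (4 * k) (TangentSpace I x) →ₗ[ℝ] ℝ :=
    { toFun := fun η ↦ η v, map_add' := fun _ _ ↦ rfl, map_smul' := fun _ _ ↦ rfl }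
  change evalAt (eulerFormOfBasis D s.toBasis) = _
  simp only [eulerFormOfBasis, curvatureMatrix_eq_flip_curvatureBiForm D hD,
    sign_smul_eq_permSgn_smul, map_smul, map_sum, smul_eq_mul]
  refine (congrArg _ hs).trans ?_
  field_simp

variable [RiemannianBundle (fun x : M ↦ TangentSpace I x)]

/-- The right-hand side does not involve `s`: the frame survives only as the value of the fibre
volume element on it, which is 1. This is what yields independence of the frame. -/
theorem eulerFormOfBasis_eq_smul_riemannianVolumeForm {k : ℕ} (hE : Module.finrank ℝ E = 4 * k)
    (hF : Module.finrank ℝ F = 4 * k)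
    (oM : BundleOrientation E (fun x : M ↦ TangentSpace I x) (4 * k))
    (oV : BundleOrientation F V (4 * k)) (D : CovariantDerivative I F V)
    [D.ContMDiffCovariantDerivative ∞] (hD : D.IsMetricCompatible) {x : M}
    (s : OrthonormalBasis (Fin (4 * k)) ℝ (V x)) (hs : s.toBasis.orientation = oV.fiber x) :
    eulerFormOfBasis D s.toBasis =
      (1 / ((2 * Real.pi) ^ (2 * k) * (2 * k).factorial) *
        (curvaturePowNormSq hE hF oM oV D hD 1 1 x - curvaturePowNormSq hE hF oM oV D hD 1 (-1) x
          - curvaturePowNormSq hE hF oM oV D hD (-1) 1 x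
          + curvaturePowNormSq hE hF oM oV D hD (-1) (-1) x)) •
        riemannianVolumeForm hE oM x := by
  have : FiniteDimensional ℝ (TangentSpace I x) :=
    VectorBundle.finiteDimensional ℝ E (fun x : M ↦ TangentSpace I x) x
  have : FiniteDimensional ℝ (V x) := VectorBundle.finiteDimensional ℝ F V x
  have h : 2 * k + 2 * k = 4 * k := by ring
  ext v
  rw [eulerFormOfBasis_apply D hD s h v]
  have hw := BiForm.wedge_self_apply_eq (finrank_fiber (fun x : M ↦ TangentSpace I x) hE x)
    (finrank_fiber V hF x) (oM.fiber x) (oV.fiber x) ((D.curvatureBiForm hD x).pow k) h v s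
  rw [volumeElement_apply_of_orientation_eq _ _ s hs, mul_one] at hw
  refine (congrArg _ hw).trans ?_
  rw [← mul_assoc]
  rfl

end Euler

end

theorem mainTheorem3 {k : ℕ} (hk : 0 < k)
    {E : Type*} [NormedAddCommGroup E] [NormedSpace ℝ E] [FiniteDimensional ℝ E]
    (hE : Module.finrank ℝ E = 4 * k)
    {H : Type*} [TopologicalSpace H] {I : ModelWithCorners ℝ E H} [I.Boundaryless]
    {M : Type*} [TopologicalSpace M] [T2Space M] [ChartedSpace H M] [IsManifold I ∞ M]
    [RiemannianBundle (fun x : M ↦ TangentSpace I x)]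
    [IsContMDiffRiemannianBundle I ∞ E (fun x : M ↦ TangentSpace I x)]
    (oM : BundleOrientation E (fun x : M ↦ TangentSpace I x) (4 * k))
    {F : Type*} [NormedAddCommGroup F] [NormedSpace ℝ F] [FiniteDimensional ℝ F]
    (hF : Module.finrank ℝ F = 4 * k)
    {V : M → Type*} [TopologicalSpace (TotalSpace F V)]
    [∀ x, NormedAddCommGroup (V x)] [∀ x, InnerProductSpace ℝ (V x)]
    [FiberBundle F V] [VectorBundle ℝ F V] [ContMDiffVectorBundle ∞ F V I]
    [IsContMDiffRiemannianBundle I ∞ F V]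
    (oV : BundleOrientation F V (4 * k))
    (D : CovariantDerivative I F V) [D.ContMDiffCovariantDerivative ∞]
    (hD : D.IsMetricCompatible) (x : M) :
    (∀ s : OrthonormalBasis (Fin (4 * k)) ℝ (V x), s.toBasis.orientation = oV.fiber x →
      eulerFormOfBasis D s.toBasis = eulerForm hk hF D oV x) ∧
    eulerForm hk hF D oV x =
      (1 / ((2 * Real.pi) ^ (2 * k) * (2 * k).factorial) *
        (curvaturePowNormSq hE hF oM oV D hD 1 1 x - curvaturePowNormSq hE hF oM oV D hD 1 (-1) x
          - curvaturePowNormSq hE hF oM oV D hD (-1) 1 x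
          + curvaturePowNormSq hE hF oM oV D hD (-1) (-1) x)) •
        riemannianVolumeForm hE oM x := by
  -- The basis chosen in `eulerForm` is itself orthonormal and positively oriented, so both claims
  -- are instances of one formula.
  have key := fun (s : OrthonormalBasis (Fin (4 * k)) ℝ (V x))
    (hs : s.toBasis.orientation = oV.fiber x) ↦
      eulerFormOfBasis_eq_smul_riemannianVolumeForm hE hF oM oV D hD s hs
  have h : eulerForm hk hF D oV x = _ :=
    key _ ((oV.fiber x).finOrthonormalBasis_orientation (by omega) (finrank_fiber V hF x))
  exact ⟨fun s hs ↦ (key s hs).trans h.symm, h⟩
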